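/- Let $q\ge 2$, $m,d\in\mathbb N$, and let $s_0,\dots,s_{q-1}\in\mathbb R^{q-1}$ be a simplex code: $\|s_j\|=1$, $\langle s_j,s_i\rangle=-\frac1{q-1}$ for $i\ne j$, and $\sum_j s_j=0$. Let $K\subset\mathbb R^d$, let $x\in K$ with $\|x\|=1$, and let $w(K)=\mathbb E\sup_{z\in K-K}\langle g,z\rangle\in[0,\infty]$, $g\sim\mathcal N(0,I_d)$, be the Gaussian mean width of $K$. Let $W_1,\dots,W_m\in\mathbb R^{(q-1)\times d}$ be independent matrices with independent standard Gaussian entries. Given labels $y_1,\dots,y_m\in\{0,\dots,q-1\}$, let $\hat x_m$ denote any maximizer of $u\mapsto\frac1m\sum_{i=1}^m\langle s_{y_i},W_iu\rangle$ over $u\in K\cap\mathbb B^d$, where $\mathbb B^d$ is the closed Euclidean unit ball. There are universal constants $C,c,c_0>0$ such that the following holds. 1. (Noise before quantization.) Let $\sigma\ge0$ and $y_i\in\arg\max_{0\le j\le q-1}\{\langle s_j,W_ix\rangle+g_{i,j}\}$, where the $g_{i,j}\sim\mathcal N(0,\sigma^2)$ are independent of each other and of the $W_i$. Then $\mathbb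 E\langle s_{y_i},W_ix\rangle\ge c_0\sqrt{\frac{\log q}{1+\sigma^2}}$ for every $i$. Moreover, for every $\delta>0$ with $m\ge C\delta^{-2}w(K)^2$, with probability at least $1-8\exp(-c\delta^2m)$ every such $\hat x_m$ satisfies $$\|\hat x_m-x\|^2\le\frac{\delta\sqrt{1+\sigma^2}}{\sqrt{\log q}}.$$ 2. (Inexact maximum.) Let $\frac12<p\le1$ and, independently for each $i$ and independently of $W_1,\dots,W_m$, let $y_i\in\arg\max_{0\le j\le q-1}\langle s_j,W_ix\rangle$ with probability $p$, and $y_i=r_i$ with probability $1-p$, where $r_i$ is drawn uniformly at random from $\{0,\dots,q-1\}$. Then $\mathbb E\langle s_{y_i},W_ix\rangle\ge c_0(2p-1)\sqrt{\log q}$ for every $i$. Moreover, for every $\delta>0$ with $m\ge C\delta^{-2}w(K)^2$, with probability at least $1-8\exp(-c_q\delta^2m)$ every such $\hat x_m$ satisfies $$\|\hat x_m-x\|^2\le\frac{\delta}{\sqrt{\log q}\,(2p-1)},$$ where $c_q=c/\log q$; if $\delta\le1$, the same holds with $c_q$ replaced by the universal constant $c$. -/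

import Mathlib

open MeasureTheory ProbabilityTheory
open scoped ENNReal NNReal Pointwise RealInnerProductSpace

namespace QaryCS

noncomputable section

/-- A simplex coding map `s : {0, …, q-1} → ℝ^{q-1}`. -/
structure IsSimplexCode {q : ℕ} (s : Fin q → EuclideanSpace ℝ (Fin (q - 1))) : Prop where
  norm_sq_eq : ∀ j, ‖s j‖ ^ 2 = 1
  inner_eq : ∀ i j, i ≠ j → ⟪s j, s i⟫ = -(1 / ((q : ℝ) - 1))
  sum_eq : ∑ j, s j = 0

/-- The Gaussian mean width `w(K) = 𝔼 sup_{z ∈ K - K} ⟨g, z⟩`, with values in `[0, ∞]`.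
For nonempty `K` the supremum is nonnegative because `0 ∈ K - K`, so that truncating each term at
`0` does not change it. -/
def meanWidth {d : ℕ} (K : Set (EuclideanSpace ℝ (Fin d))) : ℝ≥0∞ :=
  ∫⁻ g, ⨆ z ∈ K - K, ENNReal.ofReal ⟪g, z⟫ ∂(stdGaussian (EuclideanSpace ℝ (Fin d)))

/-- The law of an `n × d` matrix (as an array of entries) with independent standard Gaussian entries. -/
def gaussianMatrix (n d : ℕ) : Measure (Fin n → Fin d → ℝ) :=
  Measure.pi fun _ => Measure.pi fun _ => gaussianReal 0 1

/-- The correlation `⟨s_j, A u⟩` between the codeword of the label `j` and the vector `A u`, where `A` is a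
matrix given by its entries. -/
def correlation {q d : ℕ} (s : Fin q → EuclideanSpace ℝ (Fin (q - 1)))
    (A : Fin (q - 1) → Fin d → ℝ) (j : Fin q) (u : EuclideanSpace ℝ (Fin d)) : ℝ :=
  ⟪s j, (Matrix.of A).toEuclideanLin u⟫

/-- `v` is a solution of the recovery problem: a maximizer of
`u ↦ m⁻¹ ∑ i, ⟨s_{y_i}, W_i u⟩` over `u ∈ K ∩ 𝔹^d`. -/
def IsSolution {q d m : ℕ} (s : Fin q → EuclideanSpace ℝ (Fin (q - 1)))
    (K : Set (EuclideanSpace ℝ (Fin d))) (W : Fin m → Fin (q - 1) → Fin d → ℝ)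
    (y : Fin m → Fin q) (v : EuclideanSpace ℝ (Fin d)) : Prop :=
  v ∈ K ∩ Metric.closedBall 0 1 ∧
    ∀ u ∈ K ∩ Metric.closedBall 0 1,
      (1 / (m : ℝ)) * ∑ i, correlation s (W i) (y i) u
        ≤ (1 / (m : ℝ)) * ∑ i, correlation s (W i) (y i) v

variable {Ω : Type*} [MeasurableSpace Ω]

/-- Noise before quantization: the `W_i` are Gaussian matrices, the `g_i` are vectors of `q` Gaussian
variables of variance `σ²`, everything is independent (the joint law is a product), and almost surely
`y_i ∈ argmax_j (⟨s_j, W_i x⟩ + g_{i,j})` for all `i`. -/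
structure NoiseBeforeQuantization {q d m : ℕ} (s : Fin q → EuclideanSpace ℝ (Fin (q - 1)))
    (x : EuclideanSpace ℝ (Fin d)) (σ : ℝ≥0) (P : Measure Ω)
    (W : Fin m → Ω → Fin (q - 1) → Fin d → ℝ) (g : Fin m → Ω → Fin q → ℝ)
    (y : Fin m → Ω → Fin q) : Prop where
  law : HasLaw (fun ω i => (W i ω, g i ω))
    (Measure.pi fun _ : Fin m =>
      (gaussianMatrix (q - 1) d).prod (Measure.pi fun _ : Fin q => gaussianReal 0 (σ ^ 2))) P
  label : ∀ᵐ ω ∂P, ∀ i, ∀ j,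
    correlation s (W i ω) j x + g i ω j ≤ correlation s (W i ω) (y i ω) x + g i ω (y i ω)

/-- Inexact maximum: the `W_i` are Gaussian matrices, the `b_i` are Bernoulli variables with
`P(b_i = true) = p`, the `r_i` are uniform on `{0, …, q-1}`, everything is independent (the joint law
is a product), and almost surely, for all `i`, the label `y_i` lies in `argmax_j ⟨s_j, W_i x⟩` if
`b_i = true`, and `y_i = r_i` otherwise. -/
structure InexactMaximum {q d m : ℕ} (s : Fin q → EuclideanSpace ℝ (Fin (q - 1)))
    (x : EuclideanSpace ℝ (Fin d)) (p : unitInterval) (P : Measure Ω)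
    (W : Fin m → Ω → Fin (q - 1) → Fin d → ℝ) (b : Fin m → Ω → Bool)
    (r : Fin m → Ω → Fin q) (y : Fin m → Ω → Fin q) : Prop where
  law : HasLaw (fun ω i => (W i ω, b i ω, r i ω))
    (Measure.pi fun _ : Fin m =>
      (gaussianMatrix (q - 1) d).prod
        ((bernoulliMeasure true false p).prod (uniformOn (Set.univ : Set (Fin q))))) P
  label : ∀ᵐ ω ∂P, ∀ i,
    (b i ω = true → ∀ j, correlation s (W i ω) j x ≤ correlation s (W i ω) (y i ω) x) ∧
    (b i ω = false → y i ω = r i ω)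

/-- With probability at least `1 - η`, every solution `v` of the recovery problem satisfies
`‖v - x‖² ≤ ε`. -/
def RecoversWithin {q d m : ℕ} (s : Fin q → EuclideanSpace ℝ (Fin (q - 1)))
    (K : Set (EuclideanSpace ℝ (Fin d))) (x : EuclideanSpace ℝ (Fin d)) (P : Measure Ω)
    (W : Fin m → Ω → Fin (q - 1) → Fin d → ℝ) (y : Fin m → Ω → Fin q)
    (ε η : ℝ) : Prop :=
  ∃ E : Set Ω, MeasurableSet E ∧ ENNReal.ofReal (1 - η) ≤ P E ∧
    ∀ ω ∈ E, ∀ v, IsSolution s K (fun i => W i ω) (fun i => y i ω) v → ‖v - x‖ ^ 2 ≤ ε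

end

end QaryCS

/-!
Write `x` for the signal and decompose each `Wᵢ u` as `⟪x, u⟫ • Wᵢ x + Wᵢ (u - ⟪x, u⟫ • x)`. With
`ξᵢ = ⟪s_{yᵢ}, Wᵢ x⟫` and `h` the sum of the components of `Wᵢᵀ s_{yᵢ}` orthogonal to `x`, divided
by `√m`, optimality of `v` against `x` reads `(∑ ξᵢ) (1 - ⟪x, v⟫) ≤ √m ⟪h, v - x⟫`, while `‖v - x‖²
≤ 2 (1 - ⟪x, v⟫)`. Hence the error is small as soon as the average of the `ξᵢ` is not much smaller
than its mean and the width of `h` over `K - K` is small (`norm_sub_sq_le_of_isSolution`). The two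
events are estimated separately and combined in `recoversWithin_of_label`.

*Width.* Ties among the scores have probability zero (`IsSimplexCode.ae_score_ne`), so each label
is almost surely a fixed measurable function of `Wᵢ x` and the noise. As `Wᵢ x` is independent of
`Wᵢ u` for `u ⟂ x`, the vector `h` has the law of the projection to `xᗮ` of a standard Gaussian
vector (`map_sum_backProj`). The expected width of such a projection is at most `w(K)`, by
reflection in `xᗮ`. Concentration comes from rotation invariance: for `f g = max_i ⟪g, t i⟫` and
independent standard Gaussian `g` and `g'`, passing from `g` to `(g + g') / √2` and then to `g'`
bounds `f g - 2 f g'` by two subgaussian variables. This gives exponential moments of both signs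
(`integral_exp_argmax_le`, `integral_exp_neg_argmax_le`), with the mean lost only up to a factor
`2`.

*Correlation.* The maximum of `⟪s_j, U⟫` over `j`, for a standard Gaussian vector `U`, has mean at
least of order `√(log q)` (`IsSimplexCode.sqrt_log_le_integral_argmax`): a simplex code is a tight
frame, so the `⟪s_j, U⟫` are, up to a factor, independent Gaussian variables minus their average.
Its lower exponential moments are controlled by the same concentration argument, and Chernoff's
inequality bounds the average of the `ξᵢ` from below. Noise before quantization is equivalent to
replacing `U` by `U + V` with an independent isotropic Gaussian `V`; a rotation of the pair `(U,
V)` reduces this to the noiseless case (`IsSimplexCode.map_noisyLabel`). For an inexact maximum the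
exponential moment is a mixture in which the exact labels have weight at least `1 / 2`. The claimed
rates follow, since the error bound is trivial once it exceeds `4`.
-/

namespace QaryCS

/-! ### Measurable selection of a maximizer -/

section Selection

variable {α β ι : Type*} [MeasurableSpace α] [MeasurableSpace β] [Finite ι] [MeasurableSpace ι]
  [MeasurableSingletonClass ι]

lemma measurable_selection {τ : α → ι} (hτ : Measurable τ) {f : ι → α → β}
    (hf : ∀ i, Measurable (f i)) : Measurable fun a => f (τ a) a := by
  have h : Measurable fun p : α × ι => f p.2 p.1 := measurable_from_prod_countable_left hf
  exact h.comp (measurable_id.prodMk hτ)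

lemma exists_measurable_argmax [Nonempty ι] {φ : ι → α → ℝ} (hφ : ∀ i, Measurable (φ i)) :
    ∃ τ : α → ι, Measurable τ ∧ ∀ a i, φ i a ≤ φ (τ a) a := by
  classical
  have := Fintype.ofFinite ι
  have key : ∀ s : Finset ι, s.Nonempty →
      ∃ τ : α → ι, Measurable τ ∧ ∀ a, ∀ i ∈ s, φ i a ≤ φ (τ a) a := by
    intro s hs
    induction hs using Finset.Nonempty.cons_induction with
    | singleton j =>
      exact ⟨fun _ => j, measurable_const, fun a i hi => by rw [Finset.mem_singleton.1 hi]⟩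
    | cons j s hj _ ih =>
      obtain ⟨τ, hτ, hmax⟩ := ih
      refine ⟨fun a => if φ (τ a) a ≤ φ j a then j else τ a,
        Measurable.ite (measurableSet_le (measurable_selection hτ hφ) (hφ j)) measurable_const hτ,
        fun a i hi => ?_⟩
      beta_reduce
      rcases Finset.mem_cons.1 hi with rfl | hi
      · split_ifs with h <;> grind
      · have := hmax a i hi
        split_ifs with h <;> grind
  obtain ⟨τ, hτ, h⟩ := key Finset.univ Finset.univ_nonempty
  exact ⟨τ, hτ, fun a i => h a i (Finset.mem_univ i)⟩

end Selection

/-! ### Concentration of Gaussian maxima -/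

section Gaussian

variable {E : Type*} [NormedAddCommGroup E] [InnerProductSpace ℝ E] [FiniteDimensional ℝ E]
  [MeasurableSpace E] [BorelSpace E]

lemma map_inner_stdGaussian (t : E) :
    (stdGaussian E).map (fun x => ⟪x, t⟫) = gaussianReal 0 (‖t‖₊ ^ 2) := by
  apply Measure.ext_of_charFun
  ext c
  rw [charFun_gaussianReal, charFun_apply_real, integral_map (by fun_prop) (by fun_prop)]
  have h := charFun_stdGaussian (c • t)
  rw [charFun_apply] at h
  simp only [inner_smul_right, Complex.ofReal_mul] at h
  rw [h, norm_smul]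
  congr 1
  simp only [Real.norm_eq_abs, Complex.ofReal_mul, mul_pow, ← Complex.ofReal_pow, sq_abs]
  push_cast
  ring

lemma integrable_exp_inner_stdGaussian (c : ℝ) (t : E) :
    Integrable (fun x => Real.exp (c * ⟪x, t⟫)) (stdGaussian E) := by
  have h := integrable_exp_mul_gaussianReal (μ := 0) (v := ‖t‖₊ ^ 2) c
  rw [← map_inner_stdGaussian] at h
  exact h.comp_measurable (by fun_prop)

lemma integral_exp_inner_stdGaussian (c : ℝ) (t : E) :
    ∫ x, Real.exp (c * ⟪x, t⟫) ∂(stdGaussian E) = Real.exp (c ^ 2 * ‖t‖ ^ 2 / 2) := by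
  have h := mgf_gaussianReal (map_inner_stdGaussian t) c
  rw [mgf] at h
  rw [h]
  congr 1
  push_cast
  ring

lemma integrable_inner_stdGaussian (t : E) :
    Integrable (fun x => ⟪x, t⟫) (stdGaussian E) := by
  have h : Integrable id (gaussianReal 0 (‖t‖₊ ^ 2)) :=
    (memLp_id_gaussianReal 1).integrable (by simp)
  rw [← map_inner_stdGaussian] at h
  exact h.comp_measurable (by fun_prop)

lemma integral_inner_stdGaussian (t : E) : ∫ x, ⟪x, t⟫ ∂(stdGaussian E) = 0 := by
  have h : ∫ y, y ∂(gaussianReal 0 (‖t‖₊ ^ 2)) = 0 := integral_id_gaussianReal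
  rwa [← map_inner_stdGaussian, integral_map (by fun_prop) (by fun_prop)] at h

lemma map_rotation_stdGaussian (θ : ℝ) :
    MeasurePreserving (ContinuousLinearMap.rotation (E := E) θ)
      ((stdGaussian E).prod (stdGaussian E)) ((stdGaussian E).prod (stdGaussian E)) :=
  ⟨by fun_prop, IsGaussian.map_rotation_eq_self (by simp) θ⟩

section

variable {α ι : Type*} [MeasurableSpace α] {N : Measure α} [IsProbabilityMeasure N] [Finite ι]
  [MeasurableSpace ι] [MeasurableSingletonClass ι] {τ : α → ι}

/-- A function selected among finitely many integrable ones is dominated by the sum of their norms. -/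
lemma integrable_selection {β : Type*} [MeasurableSpace β] {μ : Measure β} {σ : β → ι}
    (hσ : Measurable σ) {f : ι → β → ℝ} (hm : ∀ i, Measurable (f i))
    (hf : ∀ i, Integrable (f i) μ) :
    Integrable (fun b => f (σ b) b) μ := by
  have := Fintype.ofFinite ι
  refine Integrable.mono' (integrable_finsetSum Finset.univ fun i _ => (hf i).norm)
    (measurable_selection hσ hm).aestronglyMeasurable (.of_forall fun b => ?_)
  exact Finset.single_le_sum (f := fun i => ‖f i b‖) (fun i _ => norm_nonneg _)
    (Finset.mem_univ (σ b))

lemma integrable_exp_inner_selection (hτ : Measurable τ) (t : ι → E) (c : ℝ) :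
    Integrable (fun p : α × E => Real.exp (c * ⟪p.2, t (τ p.1)⟫)) (N.prod (stdGaussian E)) :=
  integrable_selection (σ := fun p : α × E => τ p.1)
    (f := fun i p => Real.exp (c * ⟪p.2, t i⟫)) (by fun_prop) (fun i => by fun_prop)
    fun i => (integrable_exp_inner_stdGaussian c (t i)).comp_snd N

/-- A Gaussian vector paired with a vector selected independently of it is subgaussian. -/
lemma integral_exp_inner_selection_le (hτ : Measurable τ) {t : ι → E} {R : ℝ}
    (ht : ∀ i, ‖t i‖ ≤ R) (c : ℝ) :
    ∫ p, Real.exp (c * ⟪p.2, t (τ p.1)⟫) ∂(N.prod (stdGaussian E))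
      ≤ Real.exp (c ^ 2 * R ^ 2 / 2) := by
  rw [integral_prod _ (integrable_exp_inner_selection hτ t c)]
  simp only [integral_exp_inner_stdGaussian]
  have hle : ∀ a, Real.exp (c ^ 2 * ‖t (τ a)‖ ^ 2 / 2) ≤ Real.exp (c ^ 2 * R ^ 2 / 2) := fun a => by
    have := ht (τ a)
    gcongr
  refine (integral_mono_of_nonneg (.of_forall fun _ => by positivity)
    (integrable_const (Real.exp (c ^ 2 * R ^ 2 / 2))) (.of_forall hle)).trans ?_
  simp

end

section Concentration

variable {ι : Type*} [Finite ι] [MeasurableSpace ι] [MeasurableSingletonClass ι] {τ : E → ι}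
  {t : ι → E} {R : ℝ}

lemma integrable_inner_argmax (hτ : Measurable τ) (t : ι → E) :
    Integrable (fun x => ⟪x, t (τ x)⟫) (stdGaussian E) :=
  integrable_selection hτ (fun _ => by fun_prop) fun i => integrable_inner_stdGaussian (t i)

lemma integrable_exp_inner_argmax (hτ : Measurable τ) (t : ι → E) (c : ℝ) :
    Integrable (fun x => Real.exp (c * ⟪x, t (τ x)⟫)) (stdGaussian E) :=
  integrable_selection (f := fun i x => Real.exp (c * ⟪x, t i⟫)) hτ
    (fun _ => by fun_prop) fun i => integrable_exp_inner_stdGaussian c (t i)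

/-- The function `f x = max_i ⟪x, t i⟫` is sublinear. Comparing `f` at `x`, at `(x + y) / √2` and at
`y` through the maximizers at the first two points bounds `f x - 2 * f y` by two subgaussian
variables, because each of these two points is independent of the direction in which one moves away
from it. -/
lemma integral_exp_argmax_mul_le (hτ : Measurable τ) (hmax : ∀ x i, ⟪x, t i⟫ ≤ ⟪x, t (τ x)⟫)
    (ht : ∀ i, ‖t i‖ ≤ R) {μ : ℝ} (hμ : 0 ≤ μ) :
    (∫ x, Real.exp (μ * ⟪x, t (τ x)⟫) ∂(stdGaussian E)) *
      (∫ x, Real.exp (-2 * μ * ⟪x, t (τ x)⟫) ∂(stdGaussian E)) ≤ Real.exp (4 * μ ^ 2 * R ^ 2) := by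
  set γ := stdGaussian E
  let rot := ContinuousLinearMap.rotation (E := E) (Real.pi / 4)
  have hrot : MeasurePreserving rot (γ.prod γ) (γ.prod γ) := map_rotation_stdGaussian _
  let F₁ : E × E → ℝ := fun p => Real.exp (-(2 * √2 * μ) * ⟪p.2, t (τ p.1)⟫)
  let F₂ : E × E → ℝ := fun p => Real.exp (-(2 * μ) * ⟪p.2, t (τ p.1)⟫)
  have hF₁ : Integrable F₁ (γ.prod γ) := integrable_exp_inner_selection hτ t _
  have hF₂ : Integrable F₂ (γ.prod γ) := integrable_exp_inner_selection hτ t _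
  have hF₁' : Integrable (fun p => F₁ (rot p)) (γ.prod γ) := hrot.integrable_comp_of_integrable hF₁
  have hs : √2 * √2 = 2 := Real.mul_self_sqrt (by norm_num)
  have hpt : ∀ p : E × E, Real.exp (μ * ⟪p.1, t (τ p.1)⟫) * Real.exp (-2 * μ * ⟪p.2, t (τ p.2)⟫)
      ≤ (1 / 2) * F₁ (rot p) + (1 / 2) * F₂ p := by
    rintro ⟨x, y⟩
    have hconv : ∀ a b : ℝ,
        Real.exp (a + b) ≤ (1 / 2) * Real.exp (2 * a) + (1 / 2) * Real.exp (2 * b) := by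
      intro a b
      rw [Real.exp_add, two_mul a, two_mul b, Real.exp_add a a, Real.exp_add b b]
      nlinarith [sq_nonneg (Real.exp a - Real.exp b)]
    set u := (rot (x, y)).1 with hu
    set v := (rot (x, y)).2 with hv
    have hu' : u = (√2 / 2) • x + (√2 / 2) • y := by
      simp [hu, rot, ContinuousLinearMap.rotation_apply]
    have hv' : v = -(√2 / 2) • x + (√2 / 2) • y := by
      simp [hv, rot, ContinuousLinearMap.rotation_apply]
    -- `x` and `y` are recovered from the rotated pair: moving from `x` to `u` costs the pairing with
    -- `y`, and moving from `u` to `y` costs the pairing with `v`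
    have hx : x = √2 • u - y := by
      rw [hu', smul_add, smul_smul, smul_smul, show √2 * (√2 / 2) = 1 by linarith]; simp
    have hu2 : u = √2 • y - v := by
      rw [hu', hv']; module
    have h1 : ⟪x, t (τ x)⟫ ≤ √2 * ⟪u, t (τ u)⟫ - ⟪y, t (τ x)⟫ := by
      have : ⟪x, t (τ x)⟫ = √2 * ⟪u, t (τ x)⟫ - ⟪y, t (τ x)⟫ := by
        nth_rewrite 1 [hx]
        rw [inner_sub_left, real_inner_smul_left]
      rw [this]
      have := hmax u (τ x)
      gcongr
    have h2 : ⟪u, t (τ u)⟫ ≤ √2 * ⟪y, t (τ y)⟫ - ⟪v, t (τ u)⟫ := by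
      have : ⟪u, t (τ u)⟫ = √2 * ⟪y, t (τ u)⟫ - ⟪v, t (τ u)⟫ := by
        nth_rewrite 1 [hu2]
        rw [inner_sub_left, real_inner_smul_left]
      rw [this]
      have := hmax y (τ u)
      gcongr
    have h3 : ⟪x, t (τ x)⟫ ≤ 2 * ⟪y, t (τ y)⟫ - √2 * ⟪v, t (τ u)⟫ - ⟪y, t (τ x)⟫ := by
      have := mul_le_mul_of_nonneg_left h2 (Real.sqrt_nonneg 2)
      rw [mul_sub, ← mul_assoc, hs] at this
      linarith
    have h4 := mul_le_mul_of_nonneg_left h3 hμ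
    calc Real.exp (μ * ⟪x, t (τ x)⟫) * Real.exp (-2 * μ * ⟪y, t (τ y)⟫)
        = Real.exp (μ * ⟪x, t (τ x)⟫ + -2 * μ * ⟪y, t (τ y)⟫) := (Real.exp_add _ _).symm
      _ ≤ Real.exp ((-(√2 * μ) * ⟪v, t (τ u)⟫) + (-μ * ⟪y, t (τ x)⟫)) := by
          apply Real.exp_le_exp.2; linarith
      _ ≤ _ := by
          refine (hconv _ _).trans (le_of_eq ?_)
          simp only [F₁, F₂, ← hu, ← hv]
          congr 3 <;> ring_nf
  have hint := (hF₁'.const_mul (1 / 2)).add (hF₂.const_mul (1 / 2))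
  have e1 : ∫ p, F₁ (rot p) ∂(γ.prod γ) = ∫ p, F₁ p ∂(γ.prod γ) := by
    have := integral_map (μ := γ.prod γ) (φ := rot) hrot.measurable.aemeasurable
      (f := F₁) (by rw [hrot.map_eq]; exact hF₁.aestronglyMeasurable)
    rw [hrot.map_eq] at this
    exact this.symm
  have b1 : ∫ p, F₁ p ∂(γ.prod γ) ≤ Real.exp (4 * μ ^ 2 * R ^ 2) := by
    refine (integral_exp_inner_selection_le hτ ht _).trans (Real.exp_le_exp.2 (le_of_eq ?_))
    have : (-(2 * √2 * μ)) ^ 2 = 4 * (√2 * √2) * μ ^ 2 := by ring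
    rw [this, hs]; ring
  have b2 : ∫ p, F₂ p ∂(γ.prod γ) ≤ Real.exp (4 * μ ^ 2 * R ^ 2) := by
    refine (integral_exp_inner_selection_le hτ ht _).trans (Real.exp_le_exp.2 ?_)
    nlinarith [mul_nonneg (sq_nonneg μ) (sq_nonneg R)]
  rw [← integral_prod_mul]
  refine (integral_mono_of_nonneg (.of_forall fun _ => by positivity) hint
    (.of_forall hpt)).trans ?_
  simp only [Pi.add_apply]
  rw [integral_add (hF₁'.const_mul _) (hF₂.const_mul _), integral_const_mul, integral_const_mul, e1]
  linarith

/-- Lower exponential moments of a Gaussian maximum. -/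
lemma integral_exp_neg_argmax_le (hτ : Measurable τ) (hmax : ∀ x i, ⟪x, t i⟫ ≤ ⟪x, t (τ x)⟫)
    (ht : ∀ i, ‖t i‖ ≤ R) {μ : ℝ} (hμ : 0 ≤ μ) :
    ∫ x, Real.exp (-2 * μ * ⟪x, t (τ x)⟫) ∂(stdGaussian E)
      ≤ Real.exp (4 * μ ^ 2 * R ^ 2 - μ * ∫ x, ⟪x, t (τ x)⟫ ∂(stdGaussian E)) := by
  have h := integral_exp_argmax_mul_le hτ hmax ht hμ
  have hj : Real.exp (μ * ∫ x, ⟪x, t (τ x)⟫ ∂(stdGaussian E))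
      ≤ ∫ x, Real.exp (μ * ⟪x, t (τ x)⟫) ∂(stdGaussian E) := by
    rw [← integral_const_mul]
    exact convexOn_exp.map_integral_le Real.continuous_exp.continuousOn isClosed_univ (by simp)
      ((integrable_inner_argmax hτ t).const_mul μ) (integrable_exp_inner_argmax hτ t μ)
  have h0 : 0 ≤ ∫ x, Real.exp (-2 * μ * ⟪x, t (τ x)⟫) ∂(stdGaussian E) :=
    integral_nonneg fun _ => by positivity
  rw [Real.exp_sub, le_div_iff₀ (Real.exp_pos _), mul_comm]
  exact (mul_le_mul_of_nonneg_right hj h0).trans h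

/-- Upper exponential moments of a Gaussian maximum. -/
lemma integral_exp_argmax_le (hτ : Measurable τ) (hmax : ∀ x i, ⟪x, t i⟫ ≤ ⟪x, t (τ x)⟫)
    (ht : ∀ i, ‖t i‖ ≤ R) {μ : ℝ} (hμ : 0 ≤ μ) :
    ∫ x, Real.exp (μ * ⟪x, t (τ x)⟫) ∂(stdGaussian E)
      ≤ Real.exp (4 * μ ^ 2 * R ^ 2 + 2 * μ * ∫ x, ⟪x, t (τ x)⟫ ∂(stdGaussian E)) := by
  have h := integral_exp_argmax_mul_le hτ hmax ht hμ
  have hj : Real.exp (-2 * μ * ∫ x, ⟪x, t (τ x)⟫ ∂(stdGaussian E))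
      ≤ ∫ x, Real.exp (-2 * μ * ⟪x, t (τ x)⟫) ∂(stdGaussian E) := by
    rw [← integral_const_mul]
    exact convexOn_exp.map_integral_le Real.continuous_exp.continuousOn isClosed_univ (by simp)
      ((integrable_inner_argmax hτ t).const_mul _) (integrable_exp_inner_argmax hτ t _)
  have h0 : 0 ≤ ∫ x, Real.exp (μ * ⟪x, t (τ x)⟫) ∂(stdGaussian E) :=
    integral_nonneg fun _ => by positivity
  rw [show (4 * μ ^ 2 * R ^ 2 + 2 * μ * ∫ x, ⟪x, t (τ x)⟫ ∂(stdGaussian E))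
    = 4 * μ ^ 2 * R ^ 2 - (-2 * μ * ∫ x, ⟪x, t (τ x)⟫ ∂(stdGaussian E)) by ring, Real.exp_sub,
    le_div_iff₀ (Real.exp_pos _)]
  exact (mul_le_mul_of_nonneg_left hj h0).trans h

end Concentration

end Gaussian

/-! ### Gaussian matrices -/

section GaussianMatrix

variable {n d : ℕ}

instance isProbabilityMeasure_gaussianMatrix : IsProbabilityMeasure (gaussianMatrix n d) := by
  unfold gaussianMatrix; infer_instance

/-- The product of the matrix with entries `A` and the vector `u`. -/
noncomputable def matVec (A : Fin n → Fin d → ℝ) (u : EuclideanSpace ℝ (Fin d)) :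
    EuclideanSpace ℝ (Fin n) :=
  (Matrix.of A).toEuclideanLin u

/-- The product of the transpose of the matrix with entries `A` and the vector `a`. -/
noncomputable def vecMat (A : Fin n → Fin d → ℝ) (a : EuclideanSpace ℝ (Fin n)) :
    EuclideanSpace ℝ (Fin d) :=
  (Matrix.of A).transpose.toEuclideanLin a

lemma inner_matVec (A : Fin n → Fin d → ℝ) (a : EuclideanSpace ℝ (Fin n))
    (u : EuclideanSpace ℝ (Fin d)) : ⟪a, matVec A u⟫ = ∑ k, ∑ l, A k l * (a k * u l) := by
  simp only [matVec, PiLp.inner_apply, Matrix.ofLp_toLpLin, Matrix.toLin'_apply, Matrix.mulVec,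
    dotProduct, Matrix.of_apply, RCLike.inner_apply, conj_trivial, Finset.sum_mul]
  exact Finset.sum_congr rfl fun k _ => Finset.sum_congr rfl fun l _ => by ring

lemma inner_vecMat (A : Fin n → Fin d → ℝ) (a : EuclideanSpace ℝ (Fin n))
    (u : EuclideanSpace ℝ (Fin d)) : ⟪vecMat A a, u⟫ = ⟪a, matVec A u⟫ := by
  rw [inner_matVec, Finset.sum_comm]
  simp only [vecMat, PiLp.inner_apply, Matrix.ofLp_toLpLin, Matrix.toLin'_apply, Matrix.mulVec,
    dotProduct, Matrix.of_apply, RCLike.inner_apply, conj_trivial, Finset.mul_sum,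
    Matrix.transpose_apply]
  exact Finset.sum_congr rfl fun k _ => Finset.sum_congr rfl fun l _ => by ring

@[fun_prop]
lemma measurable_matVec (u : EuclideanSpace ℝ (Fin d)) :
    Measurable fun A : Fin n → Fin d → ℝ => matVec A u := by
  refine (WithLp.measurable_toLp 2 _).comp (measurable_pi_lambda _ fun k => ?_)
  change Measurable fun A : Fin n → Fin d → ℝ => ∑ l, A k l * u l
  fun_prop

@[fun_prop]
lemma measurable_vecMat (a : EuclideanSpace ℝ (Fin n)) :
    Measurable fun A : Fin n → Fin d → ℝ => vecMat A a := by
  refine (WithLp.measurable_toLp 2 _).comp (measurable_pi_lambda _ fun k => ?_)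
  change Measurable fun A : Fin n → Fin d → ℝ => ∑ l, A l k * a l
  fun_prop

lemma integral_cexp_gaussianMatrix (c : Fin n → Fin d → ℝ) :
    ∫ A, Complex.exp ((∑ k, ∑ l, A k l * c k l : ℝ) * Complex.I) ∂(gaussianMatrix n d)
      = Complex.exp (-(∑ k, ∑ l, c k l ^ 2 : ℝ) / 2) := by
  simp only [Complex.ofReal_sum, Finset.sum_mul, Complex.exp_sum, gaussianMatrix]
  rw [integral_fintype_prod_eq_prod
    (f := fun k (a : Fin d → ℝ) => ∏ l, Complex.exp ((a l * c k l : ℝ) * Complex.I))]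
  simp only [← Finset.sum_neg_distrib, Finset.sum_div, Complex.exp_sum]
  refine Finset.prod_congr rfl fun k _ => ?_
  rw [integral_fintype_prod_eq_prod
    (f := fun l (a : ℝ) => Complex.exp ((a * c k l : ℝ) * Complex.I))]
  refine Finset.prod_congr rfl fun l _ => ?_
  have := charFun_gaussianReal (μ := 0) (v := 1) (c k l)
  rw [charFun_apply_real] at this
  simp only [Complex.ofReal_mul, mul_comm (Complex.ofReal _) (Complex.ofReal (c k l))] at this ⊢
  rw [this]
  congr 1
  push_cast
  ring

lemma integral_cexp_inner_matVec (a b : EuclideanSpace ℝ (Fin n))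
    {x u : EuclideanSpace ℝ (Fin d)} (hxu : ⟪x, u⟫ = 0) :
    ∫ A, Complex.exp ((⟪a, matVec A x⟫ + ⟪b, matVec A u⟫ : ℝ) * Complex.I) ∂(gaussianMatrix n d)
      = Complex.exp (-(‖x‖ ^ 2 * ‖a‖ ^ 2 + ‖u‖ ^ 2 * ‖b‖ ^ 2 : ℝ) / 2) := by
  simp only [inner_matVec, ← Finset.sum_add_distrib, ← mul_add]
  rw [integral_cexp_gaussianMatrix fun k l => a k * x l + b k * u l]
  congr 4
  have hxu' : ∑ l, x l * u l = 0 := by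
    simpa [PiLp.inner_apply, mul_comm] using hxu
  have : ∀ k l, (a k * x l + b k * u l) ^ 2
      = a k ^ 2 * x l ^ 2 + b k ^ 2 * u l ^ 2 + 2 * (a k * b k) * (x l * u l) :=
    fun k l => by ring
  simp only [this, Finset.sum_add_distrib, ← Finset.mul_sum, hxu', ← Finset.sum_mul,
    EuclideanSpace.real_norm_sq_eq]
  simp; ring

lemma map_matVec (u : EuclideanSpace ℝ (Fin d)) :
    (gaussianMatrix n d).map (fun A => matVec A u)
      = (stdGaussian (EuclideanSpace ℝ (Fin n))).map (fun v => ‖u‖ • v) := by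
  apply Measure.ext_of_charFun
  ext t
  rw [charFun_map_smul, charFun_stdGaussian, charFun_apply,
    integral_map (by fun_prop) (by fun_prop)]
  have := integral_cexp_inner_matVec (n := n) t 0 (x := u) (u := 0) (by simp)
  simp only [inner_zero_left, add_zero, norm_zero] at this
  simp only [real_inner_comm t, norm_smul, norm_norm]
  rw [this]
  congr 2
  push_cast
  ring

lemma indepFun_matVec {x u : EuclideanSpace ℝ (Fin d)} (hxu : ⟪x, u⟫ = 0) :
    IndepFun (fun A => matVec A x) (fun A => matVec A u) (gaussianMatrix n d) := by
  rw [indepFun_iff_charFun_prod (by fun_prop) (by fun_prop)]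
  intro t
  rw [map_matVec, map_matVec, charFun_map_smul, charFun_map_smul, charFun_stdGaussian,
    charFun_stdGaussian, charFun_apply, integral_map (by fun_prop) (by fun_prop)]
  have := integral_cexp_inner_matVec t.ofLp.1 t.ofLp.2 hxu
  simp only [WithLp.prod_inner_apply, real_inner_comm _ t.ofLp.1, real_inner_comm _ t.ofLp.2] at *
  rw [this, ← Complex.exp_add]
  congr 1
  simp only [norm_smul, norm_norm]
  push_cast
  ring

end GaussianMatrix

/-! ### Back-projections orthogonal to the signal -/

section Perp

variable {E : Type*} [NormedAddCommGroup E] [InnerProductSpace ℝ E]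

/-- The component of `z` orthogonal to the unit vector `x`. -/
def perp (x z : E) : E := z - ⟪x, z⟫ • x

lemma inner_perp_left (x a b : E) : ⟪perp x a, b⟫ = ⟪a, perp x b⟫ := by
  simp only [perp, inner_sub_left, inner_sub_right, real_inner_smul_left, real_inner_smul_right,
    real_inner_comm a x]
  ring

lemma inner_perp_self {x : E} (hx : ‖x‖ = 1) (z : E) : ⟪x, perp x z⟫ = 0 := by
  simp [perp, inner_sub_right, real_inner_smul_right, hx]

lemma perp_self {x : E} (hx : ‖x‖ = 1) : perp x x = 0 := by
  simp [perp, hx]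

lemma norm_perp_le {x : E} (hx : ‖x‖ = 1) (z : E) : ‖perp x z‖ ≤ ‖z‖ := by
  have h : ‖perp x z‖ ^ 2 = ‖z‖ ^ 2 - ⟪x, z⟫ ^ 2 := by
    rw [perp, norm_sub_sq_real, norm_smul, real_inner_smul_right, real_inner_comm, hx]
    simp; ring
  exact abs_le_of_sq_le_sq' (by nlinarith [sq_nonneg ⟪x, z⟫]) (norm_nonneg z) |>.2

lemma perp_sub (x a b : E) : perp x (a - b) = perp x a - perp x b := by
  simp only [perp, inner_sub_right, sub_smul]; abel

lemma perp_smul (x : E) (c : ℝ) (a : E) : perp x (c • a) = c • perp x a := by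
  simp only [perp, inner_smul_right, smul_sub, smul_smul]

@[fun_prop]
lemma continuous_perp (x : E) : Continuous (perp x) := by
  unfold perp; fun_prop

end Perp

section Samples

variable {n d m : ℕ} {ι 𝒩 : Type*} [MeasurableSpace 𝒩] [Finite ι] [MeasurableSpace ι]
  [MeasurableSingletonClass ι] {N : Measure 𝒩} [IsProbabilityMeasure N]
  {Y : EuclideanSpace ℝ (Fin n) × 𝒩 → ι} {s : ι → EuclideanSpace ℝ (Fin n)}
  {x : EuclideanSpace ℝ (Fin d)}

lemma measurePreserving_matVec (hx : ‖x‖ = 1) :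
    MeasurePreserving (fun A => matVec A x) (gaussianMatrix n d)
      (stdGaussian (EuclideanSpace ℝ (Fin n))) :=
  ⟨by fun_prop, by rw [map_matVec]; simp [hx]⟩

lemma measurePreserving_matVec_prod (hx : ‖x‖ = 1) (N : Measure 𝒩) [IsProbabilityMeasure N] :
    MeasurePreserving (fun p : (Fin n → Fin d → ℝ) × 𝒩 => (matVec p.1 x, p.2))
      ((gaussianMatrix n d).prod N) ((stdGaussian (EuclideanSpace ℝ (Fin n))).prod N) :=
  (measurePreserving_matVec hx).prod (MeasurePreserving.id N)

/-- The component orthogonal to `x` of the back-projection `Aᵀ s_Y` of one sample, where the label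
`Y` is computed from `A x` and the noise. -/
noncomputable def backProj (s : ι → EuclideanSpace ℝ (Fin n)) (x : EuclideanSpace ℝ (Fin d))
    (Y : EuclideanSpace ℝ (Fin n) × 𝒩 → ι) (p : (Fin n → Fin d → ℝ) × 𝒩) :
    EuclideanSpace ℝ (Fin d) :=
  perp x (vecMat p.1 (s (Y (matVec p.1 x, p.2))))

lemma measurable_backProj (s : ι → EuclideanSpace ℝ (Fin n)) (x : EuclideanSpace ℝ (Fin d))
    (hY : Measurable Y) : Measurable (backProj s x Y) := by
  have h1 : Measurable fun p : (Fin n → Fin d → ℝ) × 𝒩 => Y (matVec p.1 x, p.2) := by fun_prop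
  exact measurable_selection h1
    (f := fun j (p : (Fin n → Fin d → ℝ) × 𝒩) => perp x (vecMat p.1 (s j))) (fun j => by fun_prop)

lemma measurable_sum_backProj (s : ι → EuclideanSpace ℝ (Fin n)) (x : EuclideanSpace ℝ (Fin d))
    (hY : Measurable Y) :
    Measurable fun p : Fin m → (Fin n → Fin d → ℝ) × 𝒩 =>
      (1 / √m) • ∑ i, backProj s x Y (p i) := by
  have h : Measurable fun p : Fin m → (Fin n → Fin d → ℝ) × 𝒩 => ∑ i, backProj s x Y (p i) :=
    Finset.measurable_sum _ fun i _ => (measurable_backProj s x hY).comp (measurable_pi_apply i)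
  exact h.const_smul (1 / √m)

/-- The label depends on the matrix only through `A x`, which is independent of `A u` for `u`
orthogonal to `x`; hence, although the label depends on `A`, the orthogonal part of the
back-projection is the projection of a standard Gaussian vector. -/
lemma integral_cexp_backProj (hs : ∀ j, ‖s j‖ = 1) (hx : ‖x‖ = 1) (hY : Measurable Y)
    (t : EuclideanSpace ℝ (Fin d)) :
    ∫ p, Complex.exp (⟪backProj s x Y p, t⟫ * Complex.I) ∂((gaussianMatrix n d).prod N)
      = Complex.exp (-(‖perp x t‖ ^ 2 : ℝ) / 2) := by
  have hm := measurable_backProj (𝒩 := 𝒩) s x hY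
  have hint : Integrable (fun p => Complex.exp (⟪backProj s x Y p, t⟫ * Complex.I))
      ((gaussianMatrix n d).prod N) :=
    Integrable.of_bound (by fun_prop) 1 (.of_forall fun p => by
      rw [Complex.norm_exp_ofReal_mul_I])
  rw [integral_prod_symm _ hint]
  have key : ∀ ν, ∫ A, Complex.exp (⟪backProj s x Y (A, ν), t⟫ * Complex.I) ∂(gaussianMatrix n d)
      = Complex.exp (-(‖perp x t‖ ^ 2 : ℝ) / 2) := by
    intro ν
    set u := perp x t with hu
    have hxu : ⟪x, u⟫ = 0 := inner_perp_self hx t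
    let F : EuclideanSpace ℝ (Fin n) × EuclideanSpace ℝ (Fin n) → ℂ :=
      fun p => Complex.exp (⟪s (Y (p.1, ν)), p.2⟫ * Complex.I)
    have hF : Measurable F :=
      measurable_selection (τ := fun p : EuclideanSpace ℝ (Fin n) × EuclideanSpace ℝ (Fin n) =>
        Y (p.1, ν)) (f := fun j p => Complex.exp (⟪s j, p.2⟫ * Complex.I)) (by fun_prop)
        (fun j => by fun_prop)
    have h1 : ∀ A, Complex.exp (⟪backProj s x Y (A, ν), t⟫ * Complex.I)
        = F (matVec A x, matVec A u) := fun A => by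
      simp only [backProj, inner_perp_left, inner_vecMat, F, hu]
    have hind := (indepFun_iff_map_prod_eq_prod_map_map (by fun_prop) (by fun_prop)).1
      (indepFun_matVec (n := n) hxu)
    simp only [h1]
    rw [← integral_map (φ := fun A => (matVec A x, matVec A u)) (by fun_prop)
      hF.aestronglyMeasurable, hind, (measurePreserving_matVec hx).map_eq, map_matVec]
    have : IsProbabilityMeasure ((stdGaussian (EuclideanSpace ℝ (Fin n))).map (fun v => ‖u‖ • v)) :=
      Measure.isProbabilityMeasure_map (by fun_prop)
    rw [integral_prod _ (Integrable.of_bound hF.aestronglyMeasurable 1 (.of_forall fun p => by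
      simp only [F]; rw [Complex.norm_exp_ofReal_mul_I]))]
    have h2 : ∀ a, ∫ b, F (a, b) ∂((stdGaussian (EuclideanSpace ℝ (Fin n))).map (fun v => ‖u‖ • v))
        = Complex.exp (-(‖u‖ ^ 2 : ℝ) / 2) := by
      intro a
      have h3 := charFun_map_smul (μ := stdGaussian (EuclideanSpace ℝ (Fin n))) ‖u‖ (s (Y (a, ν)))
      rw [charFun_apply, charFun_stdGaussian] at h3
      simp only [F, real_inner_comm _ (s _)] at h3 ⊢
      rw [h3, norm_smul, norm_norm, hs]
      push_cast
      simp
    simp only [h2]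
    simp
  simp only [key]
  simp

/-- The normalized sum of the orthogonal parts of the back-projections is distributed as the
projection of one standard Gaussian vector. -/
lemma map_sum_backProj (hm : 0 < m) (hs : ∀ j, ‖s j‖ = 1) (hx : ‖x‖ = 1) (hY : Measurable Y) :
    (Measure.pi fun _ : Fin m => (gaussianMatrix n d).prod N).map
        (fun p => (1 / √m) • ∑ i, backProj s x Y (p i))
      = (stdGaussian (EuclideanSpace ℝ (Fin d))).map (perp x) := by
  have hmeas := measurable_backProj (𝒩 := 𝒩) s x hY
  have hsum := measurable_sum_backProj (m := m) (𝒩 := 𝒩) s x hY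
  have hprob : IsProbabilityMeasure ((Measure.pi fun _ : Fin m => (gaussianMatrix n d).prod N).map
        (fun p => (1 / √m) • ∑ i, backProj s x Y (p i))) :=
    Measure.isProbabilityMeasure_map hsum.aemeasurable
  have hprob' : IsProbabilityMeasure ((stdGaussian (EuclideanSpace ℝ (Fin d))).map (perp x)) :=
    Measure.isProbabilityMeasure_map (by fun_prop)
  apply Measure.ext_of_charFun
  ext t
  rw [charFun_apply, charFun_apply, integral_map hsum.aemeasurable (by fun_prop),
    integral_map (by fun_prop) (by fun_prop)]
  simp only [inner_perp_left]
  rw [← charFun_apply, charFun_stdGaussian]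
  have h1 : ∀ p : Fin m → (Fin n → Fin d → ℝ) × 𝒩,
      Complex.exp (⟪(1 / √m) • ∑ i, backProj s x Y (p i), t⟫ * Complex.I)
      = ∏ i, Complex.exp (⟪backProj s x Y (p i), (1 / √m) • t⟫ * Complex.I) := fun p => by
    rw [real_inner_smul_left, ← real_inner_smul_right, sum_inner, Complex.ofReal_sum,
      Finset.sum_mul, Complex.exp_sum]
  simp only [h1]
  rw [integral_fintype_prod_eq_prod (f := fun _ (p : (Fin n → Fin d → ℝ) × 𝒩) =>
    Complex.exp (⟪backProj s x Y p, (1 / √m) • t⟫ * Complex.I))]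
  simp only [integral_cexp_backProj hs hx hY, Finset.prod_const, Finset.card_univ,
    Fintype.card_fin, ← Complex.exp_nat_mul]
  congr 1
  have hm' : (m : ℝ) ≠ 0 := by positivity
  rw [perp_smul, norm_smul, mul_pow]
  have : ‖1 / √(m : ℝ)‖ ^ 2 = 1 / m := by
    rw [Real.norm_eq_abs, sq_abs, div_pow, Real.sq_sqrt (by positivity)]; simp
  rw [this]
  have hm2 : (m : ℂ) ≠ 0 := by exact_mod_cast hm'
  push_cast
  field_simp

end Samples

/-! ### Width of a projected Gaussian vector -/

section Width

variable {d : ℕ} {K T : Set (EuclideanSpace ℝ (Fin d))} {x : EuclideanSpace ℝ (Fin d)} {B : ℝ}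

/-- Projecting to the orthogonal complement of `x` does not increase the mean width, because the
projection is the average of the identity and a reflection, and both preserve the Gaussian law. -/
lemma integral_argmax_perp_le (hx : ‖x‖ = 1) {F : Finset (EuclideanSpace ℝ (Fin d))}
    (hF : ↑F ⊆ K - K) (h0 : 0 ∈ F) {τ : EuclideanSpace ℝ (Fin d) → F} (hτ : Measurable τ)
    (hmax : ∀ g (i : F), ⟪g, perp x i⟫ ≤ ⟪g, perp x (τ g)⟫) :
    ENNReal.ofReal (∫ g, ⟪g, perp x (τ g)⟫ ∂(stdGaussian (EuclideanSpace ℝ (Fin d))))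
      ≤ meanWidth K := by
  set γ := stdGaussian (EuclideanSpace ℝ (Fin d))
  let S : EuclideanSpace ℝ (Fin d) → ℝ≥0∞ := fun g =>
    ⨆ i : F, ENNReal.ofReal ⟪g, (i : EuclideanSpace ℝ (Fin d))⟫
  have hS : Measurable S := Measurable.iSup fun i => by fun_prop
  let R : EuclideanSpace ℝ (Fin d) ≃ₗᵢ[ℝ] EuclideanSpace ℝ (Fin d) := (ℝ ∙ x)ᗮ.reflection
  have hR : MeasurePreserving R γ γ := ⟨R.continuous.measurable, stdGaussian_map R⟩
  have hRg : ∀ g, R g = g - (2 * ⟪x, g⟫) • x := fun g => by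
    simp only [R, Submodule.reflection_orthogonal_apply, Submodule.reflection_singleton_apply, hx]
    simp [two_mul, add_smul, two_smul]
  have hnn : ∀ g, 0 ≤ ⟪g, perp x (τ g)⟫ := fun g => by
    have := hmax g ⟨0, h0⟩
    simpa [perp] using this
  have hSK : ∫⁻ g, S g ∂γ ≤ meanWidth K :=
    lintegral_mono fun g => iSup_le fun i =>
      le_iSup₂ (f := fun z (_ : z ∈ K - K) => ENNReal.ofReal ⟪g, z⟫) (i : EuclideanSpace ℝ (Fin d))
        (hF i.2)
  have hpt : ∀ g, ENNReal.ofReal ⟪g, perp x (τ g)⟫ ≤ 2⁻¹ * (S g + S (R g)) := by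
    intro g
    set z : EuclideanSpace ℝ (Fin d) := ↑(τ g) with hz
    have h1 : ⟪g, perp x z⟫ = 2⁻¹ * (⟪g, z⟫ + ⟪R g, z⟫) := by
      rw [hRg]
      simp only [perp, inner_sub_left, inner_sub_right, real_inner_smul_left,
        real_inner_smul_right, real_inner_comm g x]
      rw [real_inner_comm x g]
      ring
    have h2 : ENNReal.ofReal ⟪g, z⟫ ≤ S g :=
      le_iSup (fun i : F => ENNReal.ofReal ⟪g, (i : EuclideanSpace ℝ (Fin d))⟫) (τ g)
    have h3 : ENNReal.ofReal ⟪R g, z⟫ ≤ S (R g) :=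
      le_iSup (fun i : F => ENNReal.ofReal ⟪R g, (i : EuclideanSpace ℝ (Fin d))⟫) (τ g)
    rw [h1, ENNReal.ofReal_mul (by norm_num), ENNReal.ofReal_inv_of_pos (by norm_num),
      ENNReal.ofReal_ofNat]
    gcongr
    exact ENNReal.ofReal_add_le.trans (add_le_add h2 h3)
  rw [ofReal_integral_eq_lintegral_ofReal
    (integrable_inner_argmax (t := fun i : F => perp x (i : EuclideanSpace ℝ (Fin d))) hτ)
    (.of_forall hnn)]
  refine (lintegral_mono hpt).trans ?_
  rw [lintegral_const_mul _ (by fun_prop), lintegral_add_left hS, hR.lintegral_comp hS, ← two_mul,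
    ← mul_assoc, ENNReal.inv_mul_cancel (by norm_num) (by norm_num), one_mul]
  exact hSK

lemma measure_exists_perp_finset_le (hx : ‖x‖ = 1) {F : Finset (EuclideanSpace ℝ (Fin d))}
    (hF : ↑F ⊆ K - K) (h0 : 0 ∈ F) (h2 : ∀ z ∈ F, ‖z‖ ≤ 2) (hB : 0 ≤ B)
    (hw : meanWidth K ≤ ENNReal.ofReal (B / 4)) :
    (stdGaussian (EuclideanSpace ℝ (Fin d))) {g | ∃ z ∈ F, B < ⟪perp x g, z⟫}
      ≤ ENNReal.ofReal (Real.exp (-(B ^ 2 / 256))) := by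
  set γ := stdGaussian (EuclideanSpace ℝ (Fin d))
  have : Nonempty F := ⟨⟨0, h0⟩⟩
  let t : F → EuclideanSpace ℝ (Fin d) := fun i => perp x i
  obtain ⟨τ, hτ, hmax⟩ := exists_measurable_argmax
    (φ := fun (i : F) (g : EuclideanSpace ℝ (Fin d)) => ⟪g, t i⟫) (fun i => by fun_prop)
  have ht : ∀ i, ‖t i‖ ≤ 2 := fun i => (norm_perp_le hx _).trans (h2 i i.2)
  have hm : ∫ g, ⟪g, t (τ g)⟫ ∂γ ≤ B / 4 :=
    (ENNReal.ofReal_le_ofReal_iff (by positivity)).1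
      ((integral_argmax_perp_le hx hF h0 hτ hmax).trans hw)
  have hsub : {g | ∃ z ∈ F, B < ⟪perp x g, z⟫} ⊆ {g | B ≤ ⟪g, t (τ g)⟫} := by
    rintro g ⟨z, hz, hlt⟩
    rw [inner_perp_left] at hlt
    exact (hlt.le).trans (hmax g ⟨z, hz⟩)
  refine (measure_mono hsub).trans ?_
  rw [← ofReal_measureReal]
  apply ENNReal.ofReal_le_ofReal
  -- `B / 64` minimizes the exponent `-μ * B + 16 * μ ^ 2 + 2 * μ * (B / 4)`
  have hμ : 0 ≤ B / 64 := by positivity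
  refine (measure_ge_le_exp_mul_mgf B hμ (integrable_exp_inner_argmax hτ t _)).trans ?_
  have h := integral_exp_argmax_le hτ hmax ht hμ
  rw [mgf]
  refine (mul_le_mul_of_nonneg_left h (Real.exp_pos _).le).trans ?_
  rw [← Real.exp_add]
  apply Real.exp_le_exp.2
  have := mul_le_mul_of_nonneg_left hm hμ
  nlinarith

lemma measure_exists_perp_le (hx : ‖x‖ = 1) (hT : T ⊆ K - K) (h0 : 0 ∈ T)
    (h2 : ∀ z ∈ T, ‖z‖ ≤ 2) (hB : 0 ≤ B) (hw : meanWidth K ≤ ENNReal.ofReal (B / 4)) :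
    (stdGaussian (EuclideanSpace ℝ (Fin d))) {g | ∃ z ∈ T, B < ⟪perp x g, z⟫}
      ≤ ENNReal.ofReal (Real.exp (-(B ^ 2 / 256))) := by
  classical
  have : Nonempty T := ⟨⟨0, h0⟩⟩
  let F : ℕ → Finset (EuclideanSpace ℝ (Fin d)) := fun k =>
    insert 0 ((Finset.range k).image fun j =>
      (TopologicalSpace.denseSeq T j : EuclideanSpace ℝ (Fin d)))
  have hFT : ∀ k, ∀ z ∈ F k, z ∈ T := by
    intro k z hz
    rcases Finset.mem_insert.1 hz with rfl | hz
    · exact h0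
    · obtain ⟨j, -, rfl⟩ := Finset.mem_image.1 hz
      exact (TopologicalSpace.denseSeq T j).2
  have hmono : Monotone fun k => {g : EuclideanSpace ℝ (Fin d) | ∃ z ∈ F k, B < ⟪perp x g, z⟫} := by
    rintro k l hkl g ⟨z, hz, hlt⟩
    refine ⟨z, ?_, hlt⟩
    have : F k ⊆ F l := by
      simp only [F]; gcongr
    exact this hz
  have hsub : {g | ∃ z ∈ T, B < ⟪perp x g, z⟫} ⊆ ⋃ k, {g | ∃ z ∈ F k, B < ⟪perp x g, z⟫} := by
    rintro g ⟨z, hz, hlt⟩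
    have hopen : IsOpen {z : T | B < ⟪perp x g, (z : EuclideanSpace ℝ (Fin d))⟫} :=
      isOpen_lt continuous_const (by fun_prop)
    obtain ⟨-, hw, ⟨j, rfl⟩⟩ :=
      (TopologicalSpace.denseRange_denseSeq T).inter_open_nonempty _ hopen ⟨⟨z, hz⟩, hlt⟩
    refine Set.mem_iUnion.2 ⟨j + 1, _, ?_, hw⟩
    exact Finset.mem_insert_of_mem (Finset.mem_image_of_mem _ (Finset.self_mem_range_succ j))
  refine (measure_mono hsub).trans ?_
  rw [hmono.measure_iUnion]
  exact iSup_le fun k => measure_exists_perp_finset_le hx (fun z hz => hT (hFT k z hz))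
    (Finset.mem_insert_self _ _) (fun z hz => h2 z (hFT k z hz)) hB hw

end Width

/-! ### From correlation and width to recovery -/

section Recovery

variable {Ω : Type*} [MeasurableSpace Ω] {P : Measure Ω} [IsProbabilityMeasure P] {q d m : ℕ}
  {s : Fin q → EuclideanSpace ℝ (Fin (q - 1))} {K : Set (EuclideanSpace ℝ (Fin d))}
  {x : EuclideanSpace ℝ (Fin d)} {W : Fin m → Ω → Fin (q - 1) → Fin d → ℝ} {y : Fin m → Ω → Fin q}
  {ε η : ℝ}

lemma recoversWithin_of_measure_le (hη : 0 ≤ η)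
    (h : P {ω | ∃ v, IsSolution s K (fun i => W i ω) (fun i => y i ω) v ∧ ε < ‖v - x‖ ^ 2}
      ≤ ENNReal.ofReal η) :
    RecoversWithin s K x P W y ε η := by
  refine ⟨(toMeasurable P _)ᶜ, (measurableSet_toMeasurable P
    {ω | ∃ v, IsSolution s K (fun i => W i ω) (fun i => y i ω) v ∧ ε < ‖v - x‖ ^ 2}).compl, ?_, ?_⟩
  · rw [prob_compl_eq_one_sub (measurableSet_toMeasurable _ _), measure_toMeasurable,
      ENNReal.ofReal_sub _ hη, ENNReal.ofReal_one]
    exact tsub_le_tsub_left h 1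
  · intro ω hω v hv
    by_contra hlt
    exact hω (subset_toMeasurable _ _ ⟨v, hv, not_le.1 hlt⟩)

lemma norm_sub_sq_le {E : Type*} [NormedAddCommGroup E] [InnerProductSpace ℝ E] {x v : E}
    (hx : ‖x‖ = 1) (hv : ‖v‖ ≤ 1) : ‖v - x‖ ^ 2 ≤ 2 * (1 - ⟪x, v⟫) := by
  rw [norm_sub_sq_real, hx, real_inner_comm]
  nlinarith [norm_nonneg v]

/-- When the claimed error is at least the squared diameter of the ball, nothing has to be shown. -/
lemma recoversWithin_of_four_le (hx : ‖x‖ = 1) (hε : 4 ≤ ε) (hη : 0 ≤ η) :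
    RecoversWithin s K x P W y ε η := by
  apply recoversWithin_of_measure_le hη
  have : {ω | ∃ v, IsSolution s K (fun i => W i ω) (fun i => y i ω) v ∧ ε < ‖v - x‖ ^ 2} = ∅ := by
    refine Set.eq_empty_of_forall_notMem fun ω ⟨v, hv, hlt⟩ => ?_
    have h1 : ‖v‖ ≤ 1 := by simpa using hv.1.2
    have h2 : ‖v - x‖ ≤ 2 := (norm_sub_le v x).trans (by linarith)
    nlinarith [norm_nonneg (v - x)]
  rw [this]
  simp

variable {𝒩 : Type*} {Y : EuclideanSpace ℝ (Fin (q - 1)) × 𝒩 → Fin q}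

/-- The part of the correlation along `x` is that of the signal; in the orthogonal part, `v` may be
replaced by `v - x`. -/
lemma correlation_eq (hx : ‖x‖ = 1) (p : (Fin (q - 1) → Fin d → ℝ) × 𝒩)
    (v : EuclideanSpace ℝ (Fin d)) :
    correlation s p.1 (Y (matVec p.1 x, p.2)) v
      = ⟪x, v⟫ * ⟪s (Y (matVec p.1 x, p.2)), matVec p.1 x⟫ + ⟪backProj s x Y p, v - x⟫ := by
  have h1 : ⟪backProj s x Y p, v - x⟫ = ⟪s (Y (matVec p.1 x, p.2)), matVec p.1 (perp x v)⟫ := by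
    rw [backProj, inner_perp_left, inner_vecMat, perp_sub, perp_self hx, sub_zero]
  have h2 : matVec p.1 v = ⟪x, v⟫ • matVec p.1 x + matVec p.1 (perp x v) := by
    simp only [matVec, ← map_smul, ← map_add]
    congr 1
    simp [perp]
  rw [h1, ← real_inner_smul_right, ← inner_add_right, ← h2]
  rfl

/-- A maximizer cannot be far from `x` unless the average correlation of the labels with the signal
is small or the orthogonal parts of the back-projections have a large width. -/
lemma norm_sub_sq_le_of_isSolution (hm : 0 < m) (hxK : x ∈ K) (hx : ‖x‖ = 1) {ρ : ℝ} (hρ : 0 < ρ)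
    (p : Fin m → (Fin (q - 1) → Fin d → ℝ) × 𝒩)
    (h1 : m * ρ < ∑ i, ⟪s (Y (matVec (p i).1 x, (p i).2)), matVec (p i).1 x⟫)
    {v : EuclideanSpace ℝ (Fin d)}
    (h2 : ⟪(1 / √m) • ∑ i, backProj s x Y (p i), v - x⟫ ≤ ε * ρ * √m / 2)
    (hv : IsSolution s K (fun i => (p i).1) (fun i => Y (matVec (p i).1 x, (p i).2)) v) :
    ‖v - x‖ ^ 2 ≤ ε := by
  have hm' : (0 : ℝ) < m := by exact_mod_cast hm
  have hv1 : ‖v‖ ≤ 1 := by simpa using hv.1.2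
  have hle := hv.2 x ⟨hxK, by simp [hx]⟩
  have hle' := le_of_mul_le_mul_left hle (by positivity)
  simp only [correlation_eq hx (p _), Finset.sum_add_distrib, ← Finset.mul_sum, sub_self,
    inner_zero_right, add_zero, ← sum_inner, real_inner_self_eq_norm_sq,
    hx] at hle'
  rw [real_inner_smul_left] at h2
  have hsm : √(m : ℝ) * √m = m := Real.mul_self_sqrt hm'.le
  have hspos : 0 < √(m : ℝ) := Real.sqrt_pos.2 hm'
  have h3 : ⟪∑ i, backProj s x Y (p i), v - x⟫ ≤ m * (ε * ρ / 2) := by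
    have := mul_le_mul_of_nonneg_left h2 hspos.le
    rw [← mul_assoc, mul_one_div_cancel hspos.ne', one_mul] at this
    rwa [show √(m : ℝ) * (ε * ρ * √m / 2) = (√m * √m) * (ε * ρ / 2) by ring, hsm] at this
  have h4 := norm_sub_sq_le hx hv1
  by_contra! hlt
  have h5 : ε / 2 < 1 - ⟪x, v⟫ := by linarith
  have h6 : 0 ≤ 1 - ⟪x, v⟫ := by nlinarith [sq_nonneg ‖v - x‖]
  set S := ∑ i, ⟪s (Y (matVec (p i).1 x, (p i).2)), matVec (p i).1 x⟫
  have h7 : m * ρ * (1 - ⟪x, v⟫) ≤ S * (1 - ⟪x, v⟫) := mul_le_mul_of_nonneg_right h1.le h6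
  have h8 : m * ρ * (ε / 2) < m * ρ * (1 - ⟪x, v⟫) := mul_lt_mul_of_pos_left h5 (by positivity)
  nlinarith

variable [MeasurableSpace 𝒩] {N : Measure 𝒩} [IsProbabilityMeasure N] {ν : Fin m → Ω → 𝒩}

lemma integrable_exp_correlation_label (hY : Measurable Y) (c : ℝ) :
    Integrable (fun p => Real.exp (c * ⟪s (Y p), p.1⟫))
      ((stdGaussian (EuclideanSpace ℝ (Fin (q - 1)))).prod N) :=
  integrable_selection (f := fun j (p : EuclideanSpace ℝ (Fin (q - 1)) × 𝒩) =>
      Real.exp (c * ⟪s j, p.1⟫)) hY (fun j => by fun_prop) fun j => by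
    simp only [real_inner_comm _ (s j)]
    exact (integrable_exp_inner_stdGaussian c (s j)).comp_fst N

/-- Chernoff bound for the average correlation of the labels with the signal. -/
lemma measure_sum_correlation_le (hx : ‖x‖ = 1) (hY : Measurable Y) {θ ρ M : ℝ} (hθ : 0 ≤ θ)
    (hM : ∫ p, Real.exp (-θ * ⟪s (Y p), p.1⟫)
        ∂((stdGaussian (EuclideanSpace ℝ (Fin (q - 1)))).prod N)
      ≤ M) :
    (Measure.pi fun _ : Fin m => (gaussianMatrix (q - 1) d).prod N)
        {p | ∑ i, ⟪s (Y (matVec (p i).1 x, (p i).2)), matVec (p i).1 x⟫ ≤ m * ρ}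
      ≤ ENNReal.ofReal ((Real.exp (θ * ρ) * M) ^ m) := by
  have hmp := measurePreserving_matVec_prod (n := q - 1) hx N
  have hi1 : Integrable (fun p : (Fin (q - 1) → Fin d → ℝ) × 𝒩 =>
      Real.exp (-θ * ⟪s (Y (matVec p.1 x, p.2)), matVec p.1 x⟫))
      ((gaussianMatrix (q - 1) d).prod N) :=
    hmp.integrable_comp_of_integrable (integrable_exp_correlation_label (s := s) hY (-θ))
  have he : ∫ p, Real.exp (-θ * ⟪s (Y (matVec p.1 x, p.2)), matVec p.1 x⟫)
      ∂((gaussianMatrix (q - 1) d).prod N) ≤ M := by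
    refine le_trans (le_of_eq ?_) hM
    have h := integral_map (μ := (gaussianMatrix (q - 1) d).prod N) hmp.measurable.aemeasurable
      (f := fun p => Real.exp (-θ * ⟪s (Y p), p.1⟫))
      (by
        rw [hmp.map_eq]
        exact (integrable_exp_correlation_label (s := s) hY (-θ)).aestronglyMeasurable)
    rw [hmp.map_eq] at h
    exact h.symm
  have hprod : ∀ p : Fin m → (Fin (q - 1) → Fin d → ℝ) × 𝒩,
      Real.exp (-θ * ∑ i, ⟪s (Y (matVec (p i).1 x, (p i).2)), matVec (p i).1 x⟫)
      = ∏ i, Real.exp (-θ * ⟪s (Y (matVec (p i).1 x, (p i).2)), matVec (p i).1 x⟫) := fun p => by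
    rw [Finset.mul_sum, Real.exp_sum]
  rw [← ofReal_measureReal]
  apply ENNReal.ofReal_le_ofReal
  have hch := measure_le_le_exp_mul_mgf
    (μ := Measure.pi fun _ : Fin m => (gaussianMatrix (q - 1) d).prod N)
    (X := fun p => ∑ i, ⟪s (Y (matVec (p i).1 x, (p i).2)), matVec (p i).1 x⟫) (m * ρ)
    (neg_nonpos.2 hθ) (by
      simp only [hprod]
      exact Integrable.fintype_prod fun _ => hi1)
  refine hch.trans ?_
  rw [mgf]
  simp only [hprod]
  rw [integral_fintype_prod_eq_prod (f := fun _ (p : (Fin (q - 1) → Fin d → ℝ) × 𝒩) =>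
    Real.exp (-θ * ⟪s (Y (matVec p.1 x, p.2)), matVec p.1 x⟫)), Finset.prod_const,
    Finset.card_univ, Fintype.card_fin, mul_pow, ← Real.exp_nat_mul]
  have h0 : 0 ≤ ∫ p, Real.exp (-θ * ⟪s (Y (matVec p.1 x, p.2)), matVec p.1 x⟫)
      ∂((gaussianMatrix (q - 1) d).prod N) := integral_nonneg fun _ => by positivity
  rw [show - -θ * (m * ρ) = m * (θ * ρ) by ring]
  gcongr

/-- Recovery from iid samples whose labels are almost surely a function of `Wᵢ x` and the noise: the
first term of `hη` bounds the probability that the average correlation is at most `ρ`, the second one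
the probability that the width of the back-projections exceeds `ε * ρ * √m / 2`. -/
theorem recoversWithin_of_label (hm : 0 < m) (hs : ∀ j, ‖s j‖ = 1) (hxK : x ∈ K) (hx : ‖x‖ = 1)
    (hlaw : HasLaw (fun ω i => (W i ω, ν i ω))
      (Measure.pi fun _ : Fin m => (gaussianMatrix (q - 1) d).prod N) P)
    (hY : Measurable Y) (hy : ∀ᵐ ω ∂P, ∀ i, y i ω = Y (matVec (W i ω) x, ν i ω))
    {ρ θ M : ℝ} (hε : 0 ≤ ε) (hρ : 0 < ρ) (hθ : 0 ≤ θ)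
    (hw : meanWidth K ≤ ENNReal.ofReal (ε * ρ * √m / 8))
    (hM : ∫ p, Real.exp (-θ * ⟪s (Y p), p.1⟫)
        ∂((stdGaussian (EuclideanSpace ℝ (Fin (q - 1)))).prod N)
      ≤ M)
    (hη : (Real.exp (θ * ρ) * M) ^ m + Real.exp (-((ε * ρ * √m / 2) ^ 2 / 256)) ≤ η) :
    RecoversWithin s K x P W y ε η := by
  have hM0 : 0 ≤ M := le_trans (integral_nonneg fun _ => by positivity) hM
  apply recoversWithin_of_measure_le (le_trans (by positivity) hη)
  set μ := Measure.pi fun _ : Fin m => (gaussianMatrix (q - 1) d).prod N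
  set B := ε * ρ * √m / 2 with hB
  let T : Set (EuclideanSpace ℝ (Fin d)) := (fun v => v - x) '' (K ∩ Metric.closedBall 0 1)
  have hTK : T ⊆ K - K := by
    rintro _ ⟨v, hv, rfl⟩
    exact Set.sub_mem_sub hv.1 hxK
  have hT0 : 0 ∈ T := ⟨x, ⟨hxK, by simp [hx]⟩, sub_self x⟩
  have hT2 : ∀ z ∈ T, ‖z‖ ≤ 2 := by
    rintro _ ⟨v, hv, rfl⟩
    have : ‖v‖ ≤ 1 := by simpa using hv.2
    exact (norm_sub_le v x).trans (by linarith)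
  let U : Set (EuclideanSpace ℝ (Fin d)) := {g | ∃ z ∈ T, B < ⟪g, z⟫}
  have hU : IsOpen U := by
    have : U = ⋃ z ∈ T, {g | B < ⟪g, z⟫} := by ext; simp [U]
    rw [this]
    exact isOpen_biUnion fun z _ => isOpen_lt continuous_const (by fun_prop)
  let S₁ : Set (Fin m → (Fin (q - 1) → Fin d → ℝ) × 𝒩) :=
    {p | ∑ i, ⟪s (Y (matVec (p i).1 x, (p i).2)), matVec (p i).1 x⟫ ≤ m * ρ}
  let S₂ : Set (Fin m → (Fin (q - 1) → Fin d → ℝ) × 𝒩) :=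
    (fun p => (1 / √m) • ∑ i, backProj s x Y (p i)) ⁻¹' U
  have hξ : Measurable fun p : (Fin (q - 1) → Fin d → ℝ) × 𝒩 =>
      ⟪s (Y (matVec p.1 x, p.2)), matVec p.1 x⟫ :=
    measurable_selection (τ := fun p : (Fin (q - 1) → Fin d → ℝ) × 𝒩 => Y (matVec p.1 x, p.2))
      (f := fun j p => ⟪s j, matVec p.1 x⟫) (by fun_prop) (fun j => by fun_prop)
  have hS₁ : MeasurableSet S₁ :=
    measurableSet_le (Finset.measurable_sum _ fun i _ => hξ.comp (measurable_pi_apply i))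
      measurable_const
  have hsum := measurable_sum_backProj (m := m) (𝒩 := 𝒩) s x hY
  have hS₂ : MeasurableSet S₂ := hsum hU.measurableSet
  have b₁ : μ S₁ ≤ ENNReal.ofReal ((Real.exp (θ * ρ) * M) ^ m) :=
    measure_sum_correlation_le hx hY hθ hM
  have b₂ : μ S₂ ≤ ENNReal.ofReal (Real.exp (-(B ^ 2 / 256))) := by
    rw [← Measure.map_apply hsum hU.measurableSet, map_sum_backProj hm hs hx hY,
      Measure.map_apply (by fun_prop) hU.measurableSet]
    refine measure_exists_perp_le hx hTK hT0 hT2 (by positivity) ?_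
    rw [hB, div_div]
    norm_num
    exact hw
  have hsub : {ω | ∃ v, IsSolution s K (fun i => W i ω) (fun i => y i ω) v ∧ ε < ‖v - x‖ ^ 2}
      ≤ᵐ[P] {ω | (fun i => (W i ω, ν i ω)) ∈ S₁ ∪ S₂} := by
    filter_upwards [hy] with ω hω
    rintro ⟨v, hv, hlt⟩
    change (fun i => (W i ω, ν i ω)) ∈ S₁ ∪ S₂
    by_contra hcon
    rw [Set.mem_union, not_or] at hcon
    refine absurd (norm_sub_sq_le_of_isSolution (s := s) (Y := Y) (K := K) (v := v) hm hxK hx hρ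
      (fun i => (W i ω, ν i ω)) (not_le.1 hcon.1) ?_ ?_) (not_le.2 hlt)
    · by_contra! h
      exact hcon.2 ⟨v - x, ⟨v, hv.1, rfl⟩, h⟩
    · simpa only [hω] using hv
  refine (measure_mono_ae hsub).trans ?_
  rw [hlaw.measure_eq (p := fun p => p ∈ S₁ ∪ S₂) (hS₁.union hS₂)]
  refine (measure_union_le S₁ S₂).trans ((add_le_add b₁ b₂).trans ?_)
  rw [← ENNReal.ofReal_add (by positivity) (by positivity)]
  exact ENNReal.ofReal_le_ofReal hη

end Recovery

/-! ### Simplex codes -/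

section Simplex

variable {q : ℕ} {s : Fin q → EuclideanSpace ℝ (Fin (q - 1))}

lemma IsSimplexCode.norm_eq_one (hs : IsSimplexCode s) (j : Fin q) : ‖s j‖ = 1 :=
  (pow_eq_one_iff_of_nonneg (norm_nonneg _) two_ne_zero).1 (hs.norm_sq_eq j)

lemma IsSimplexCode.inner_sum (hs : IsSimplexCode s) (hq : 2 ≤ q) (c : Fin q → ℝ) (i : Fin q) :
    ⟪s i, ∑ j, c j • s j⟫ = ((q : ℝ) * c i - ∑ j, c j) / (q - 1) := by
  classical
  have hq' : (2 : ℝ) ≤ q := by exact_mod_cast hq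
  have h1 : ∀ j, ⟪s i, c j • s j⟫ = (if j = i then c i * (q / (q - 1)) else 0) - c j / (q - 1) := by
    intro j
    rw [real_inner_smul_right]
    split_ifs with h
    · subst h
      rw [real_inner_self_eq_norm_sq, hs.norm_sq_eq]
      have : (q : ℝ) - 1 ≠ 0 := by linarith
      field_simp
    · rw [hs.inner_eq j i h]; ring
  rw [_root_.inner_sum, Finset.sum_congr rfl fun j _ => h1 j, Finset.sum_sub_distrib,
    Finset.sum_ite_eq' Finset.univ i, ← Finset.sum_div]
  simp; ring

lemma IsSimplexCode.exists_sum_eq (hs : IsSimplexCode s) (hq : 2 ≤ q)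
    (u : EuclideanSpace ℝ (Fin (q - 1))) : ∃ c : Fin q → ℝ, u = ∑ j, c j • s j := by
  have hq' : (2 : ℝ) ≤ q := by exact_mod_cast hq
  let T : (Fin q → ℝ) →ₗ[ℝ] EuclideanSpace ℝ (Fin (q - 1)) := Fintype.linearCombination ℝ s
  -- all coefficients of a vanishing combination equal their average, so the kernel is a line at most
  have hker : T.ker ≤ Submodule.span ℝ {fun _ => (1 : ℝ)} := by
    intro c hc
    have hc' : ∑ j, c j • s j = 0 := hc
    rw [Submodule.mem_span_singleton]
    refine ⟨(∑ j, c j) / q, funext fun i => ?_⟩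
    have := hs.inner_sum hq c i
    rw [hc', inner_zero_right, eq_comm, div_eq_zero_iff] at this
    have h2 : (q : ℝ) * c i - ∑ j, c j = 0 := this.resolve_right (by linarith)
    simp only [Pi.smul_apply, smul_eq_mul, mul_one]
    field_simp
    linarith
  have h1 : Module.finrank ℝ T.ker ≤ 1 :=
    (Submodule.finrank_mono hker).trans ((finrank_span_le_card _).trans (by simp))
  have h2 := T.finrank_range_add_finrank_ker
  rw [Module.finrank_fin_fun] at h2
  have h3 : T.range = ⊤ := by
    apply Submodule.eq_top_of_finrank_eq
    have := Submodule.finrank_le T.range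
    rw [finrank_euclideanSpace_fin] at this ⊢
    omega
  obtain ⟨c, hc⟩ := LinearMap.range_eq_top.1 h3 u
  exact ⟨c, hc.symm⟩

/-- A simplex code is a tight frame. -/
lemma IsSimplexCode.sum_inner_sq (hs : IsSimplexCode s) (hq : 2 ≤ q)
    (u : EuclideanSpace ℝ (Fin (q - 1))) :
    ((q : ℝ) - 1) / q * ∑ j, ⟪s j, u⟫ ^ 2 = ‖u‖ ^ 2 := by
  have hq' : (2 : ℝ) ≤ q := by exact_mod_cast hq
  obtain ⟨c, hc⟩ := hs.exists_sum_eq hq u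
  have h0 : ∑ j, ⟪s j, u⟫ = 0 := by rw [← sum_inner, hs.sum_eq, inner_zero_left]
  have h1 : ‖u‖ ^ 2 = ∑ j, c j * ⟪s j, u⟫ := by
    rw [← real_inner_self_eq_norm_sq]
    nth_rewrite 1 [hc]
    rw [sum_inner]
    simp [real_inner_smul_left]
  have h2 : ∀ j, ⟪s j, u⟫ ^ 2 = (q : ℝ) / (q - 1) * (c j * ⟪s j, u⟫)
      - (∑ j, c j) / (q - 1) * ⟪s j, u⟫ := by
    intro j
    have := hs.inner_sum hq c j
    rw [← hc] at this
    rw [sq]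
    nth_rewrite 1 [this]
    ring
  rw [Finset.sum_congr rfl fun j _ => h2 j, Finset.sum_sub_distrib, ← Finset.mul_sum,
    ← Finset.mul_sum, h0, ← h1]
  have : (q : ℝ) - 1 ≠ 0 := by linarith
  field_simp
  ring

/-- The linear map that sends a score vector `c ∈ ℝ^q` to the vector whose correlations with the
codewords are the centered scores. -/
noncomputable def synthesis (s : Fin q → EuclideanSpace ℝ (Fin (q - 1))) (c : Fin q → ℝ) :
    EuclideanSpace ℝ (Fin (q - 1)) :=
  (((q : ℝ) - 1) / q) • ∑ j, c j • s j

@[fun_prop]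
lemma measurable_synthesis : Measurable (synthesis s) := by
  unfold synthesis; fun_prop

lemma IsSimplexCode.inner_synthesis (hs : IsSimplexCode s) (hq : 2 ≤ q) (c : Fin q → ℝ)
    (i : Fin q) : ⟪s i, synthesis s c⟫ = c i - (∑ j, c j) / q := by
  have hq' : (2 : ℝ) ≤ q := by exact_mod_cast hq
  rw [synthesis, real_inner_smul_right, hs.inner_sum hq]
  have : (q : ℝ) - 1 ≠ 0 := by linarith
  field_simp

/-- Independent Gaussian scores are synthesized to an isotropic Gaussian vector. -/
lemma IsSimplexCode.map_synthesis (hs : IsSimplexCode s) (hq : 2 ≤ q) (σ : ℝ≥0) :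
    (Measure.pi fun _ : Fin q => gaussianReal 0 (σ ^ 2)).map (synthesis s)
      = (stdGaussian (EuclideanSpace ℝ (Fin (q - 1)))).map
          (fun v => ((σ : ℝ) * √(((q : ℝ) - 1) / q)) • v) := by
  have hq' : (2 : ℝ) ≤ q := by exact_mod_cast hq
  have hk : 0 ≤ ((q : ℝ) - 1) / q := div_nonneg (by linarith) (by linarith)
  have : IsProbabilityMeasure
      ((Measure.pi fun _ : Fin q => gaussianReal 0 (σ ^ 2)).map (synthesis s)) :=
    Measure.isProbabilityMeasure_map (by fun_prop)
  apply Measure.ext_of_charFun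
  ext t
  rw [charFun_map_smul, charFun_stdGaussian, charFun_apply,
    integral_map (by fun_prop) (by fun_prop)]
  have h1 : ∀ c : Fin q → ℝ, Complex.exp (⟪synthesis s c, t⟫ * Complex.I)
      = ∏ j, Complex.exp (((((q : ℝ) - 1) / q * ⟪s j, t⟫ : ℝ)) * c j * Complex.I) := by
    intro c
    rw [← Complex.exp_sum, ← Finset.sum_mul]
    congr 2
    rw [synthesis, real_inner_smul_left, sum_inner, Finset.mul_sum, Complex.ofReal_sum]
    refine Finset.sum_congr rfl fun j _ => ?_
    rw [real_inner_smul_left]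
    push_cast
    ring
  simp only [h1]
  rw [integral_fintype_prod_eq_prod (f := fun j (a : ℝ) =>
    Complex.exp (((((q : ℝ) - 1) / q * ⟪s j, t⟫ : ℝ)) * a * Complex.I))]
  simp only [← charFun_apply_real, charFun_gaussianReal]
  rw [← Complex.exp_sum]
  congr 1
  have hR : ∑ j, -((σ : ℝ) ^ 2 * (((q : ℝ) - 1) / q * ⟪s j, t⟫) ^ 2 / 2)
      = -(‖(σ : ℝ) * √(((q : ℝ) - 1) / q)‖ * ‖t‖) ^ 2 / 2 := by
    rw [mul_pow ‖_‖, Real.norm_eq_abs, sq_abs, mul_pow (σ : ℝ), Real.sq_sqrt hk,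
      ← hs.sum_inner_sq hq t]
    simp only [Finset.mul_sum, ← Finset.sum_neg_distrib, Finset.sum_div]
    exact Finset.sum_congr rfl fun j _ => by ring
  simp only [Complex.ofReal_zero, mul_zero, zero_mul, zero_sub, norm_smul]
  exact_mod_cast hR

end Simplex

/-! ### The expected maximum of a Gaussian vector over a simplex code -/

section GaussianMaximum

lemma gaussianReal_Ici_ge {t : ℝ} (ht : 0 ≤ t) :
    Real.exp (-((t + 1) ^ 2 / 2)) / 3 ≤ (gaussianReal 0 1).real (Set.Ici t) := by
  have h3 : √(2 * Real.pi) ≤ 3 := by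
    rw [Real.sqrt_le_left (by norm_num)]
    linarith [Real.pi_lt_d2]
  have h0 : 0 < √(2 * Real.pi) := by positivity
  rw [measureReal_def, ← ENNReal.ofReal_le_iff_le_toReal (by finiteness),
    gaussianReal_apply 0 one_ne_zero]
  calc ENNReal.ofReal (Real.exp (-((t + 1) ^ 2 / 2)) / 3)
      = ∫⁻ _ in Set.Icc t (t + 1), ENNReal.ofReal (Real.exp (-((t + 1) ^ 2 / 2)) / 3) := by simp
    _ ≤ ∫⁻ a in Set.Icc t (t + 1), gaussianPDF 0 1 a := by
        refine setLIntegral_mono (by fun_prop) fun a ha => ?_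
        rw [gaussianPDF_def]
        apply ENNReal.ofReal_le_ofReal
        rw [gaussianPDFReal_def, div_eq_inv_mul]
        simp only [NNReal.coe_one, mul_one, sub_zero]
        gcongr
        rw [neg_div]
        have h1 := ha.1
        have h2 := ha.2
        have : a ^ 2 ≤ (t + 1) ^ 2 := by gcongr; linarith
        linarith
    _ ≤ _ := lintegral_mono_set Set.Icc_subset_Ici_self

variable {q : ℕ} {s : Fin q → EuclideanSpace ℝ (Fin (q - 1))}
  {τ : EuclideanSpace ℝ (Fin (q - 1)) → Fin q}

lemma IsSimplexCode.inner_argmax_nonneg (hs : IsSimplexCode s) (hq : 2 ≤ q)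
    (hmax : ∀ u i, ⟪u, s i⟫ ≤ ⟪u, s (τ u)⟫) (u : EuclideanSpace ℝ (Fin (q - 1))) :
    0 ≤ ⟪u, s (τ u)⟫ := by
  by_contra! h
  have h1 : ∑ j, ⟪u, s j⟫ < 0 :=
    Finset.sum_neg (fun i _ => (hmax u i).trans_lt h) ⟨⟨0, by omega⟩, Finset.mem_univ _⟩
  rw [← _root_.inner_sum, hs.sum_eq, inner_zero_right] at h1
  exact lt_irrefl _ h1

/-- The expected maximum is bounded below by a constant, because the maximum dominates the positive
part of one standard Gaussian variable. -/
lemma IsSimplexCode.const_le_integral_argmax (hs : IsSimplexCode s) (hq : 2 ≤ q) (hτ : Measurable τ)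
    (hmax : ∀ u i, ⟪u, s i⟫ ≤ ⟪u, s (τ u)⟫) :
    1 / 30 ≤ ∫ u, ⟪u, s (τ u)⟫ ∂(stdGaussian (EuclideanSpace ℝ (Fin (q - 1)))) := by
  set γ := stdGaussian (EuclideanSpace ℝ (Fin (q - 1)))
  let j : Fin q := ⟨0, by omega⟩
  have h1 := gaussianReal_Ici_ge zero_le_one
  have h2 : (gaussianReal 0 1).real (Set.Ici 1) = γ.real {u | 1 ≤ ⟪u, s j⟫} := by
    have := map_inner_stdGaussian (s j)
    have hn : ‖s j‖₊ = 1 := NNReal.eq (hs.norm_eq_one j)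
    rw [hn, one_pow] at this
    rw [← this, map_measureReal_apply (by fun_prop) measurableSet_Ici]
    rfl
  have h3 : γ.real {u | 1 ≤ ⟪u, s j⟫} ≤ ∫ u, ⟪u, s (τ u)⟫ ∂γ := by
    have hA : MeasurableSet {u : EuclideanSpace ℝ (Fin (q - 1)) | 1 ≤ ⟪u, s j⟫} :=
      measurableSet_le measurable_const (by fun_prop)
    rw [← integral_indicator_one hA]
    refine integral_mono_of_nonneg (.of_forall fun u => Set.indicator_nonneg (by simp) u)
      (integrable_inner_argmax hτ s) (.of_forall fun u => ?_)
    by_cases hu : u ∈ {u | 1 ≤ ⟪u, s j⟫}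
    · simp only [Set.indicator_of_mem hu, Pi.one_apply]
      exact le_trans hu (hmax u j)
    · simp only [Set.indicator_of_notMem hu]
      exact hs.inner_argmax_nonneg hq hmax u
  have h4 : (1 : ℝ) / 30 ≤ Real.exp (-((1 + 1) ^ 2 / 2)) / 3 := by
    have h5 : Real.exp 2 ≤ 10 := by
      have : Real.exp 2 = Real.exp 1 * Real.exp 1 := by rw [← Real.exp_add]; norm_num
      rw [this]
      nlinarith [Real.exp_one_lt_d9, Real.exp_pos 1]
    norm_num
    rw [Real.exp_neg]
    have := inv_anti₀ (Real.exp_pos 2) h5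
    linarith
  linarith

/-- Comparison with the maximum of `q` independent standard Gaussian variables. -/
lemma IsSimplexCode.le_integral_argmax (hs : IsSimplexCode s) (hq : 2 ≤ q) (hτ : Measurable τ)
    (hmax : ∀ u i, ⟪u, s i⟫ ≤ ⟪u, s (τ u)⟫) {t : ℝ} (ht : 0 ≤ t) :
    t * (1 - Real.exp (-(q * (gaussianReal 0 1).real (Set.Ici t)))) - 1
      ≤ ∫ u, ⟪u, s (τ u)⟫ ∂(stdGaussian (EuclideanSpace ℝ (Fin (q - 1)))) := by
  have hq' : (2 : ℝ) ≤ q := by exact_mod_cast hq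
  set κ := √(((q : ℝ) - 1) / q) with hκ
  have hκ0 : 0 < κ := Real.sqrt_pos.2 (div_pos (by linarith) (by linarith))
  have hκ1 : κ ≤ 1 := by
    exact Real.sqrt_le_one.2 ((div_le_one (by linarith)).2 (by linarith))
  set π := Measure.pi fun _ : Fin q => gaussianReal 0 1
  let j : Fin q := ⟨0, by omega⟩
  let A : Set (Fin q → ℝ) := Set.univ.pi fun _ => Set.Iio t
  have hA : MeasurableSet A := MeasurableSet.univ_pi fun _ => measurableSet_Iio
  have hmap : π.map (synthesis s) = (stdGaussian (EuclideanSpace ℝ (Fin (q - 1)))).map (κ • ·) := by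
    have := hs.map_synthesis hq 1
    rw [one_pow] at this
    simpa only [NNReal.coe_one, one_mul] using this
  let f : EuclideanSpace ℝ (Fin (q - 1)) → ℝ := fun u => ⟪u, s (τ (κ⁻¹ • u))⟫
  have hf : Measurable f := measurable_selection (τ := fun u => τ (κ⁻¹ • u))
    (f := fun i u => ⟪u, s i⟫) (by fun_prop) (fun i => by fun_prop)
  have hfκ : ∀ u, f (κ • u) = κ * ⟪u, s (τ u)⟫ := fun u => by
    simp only [f, smul_smul, inv_mul_cancel₀ hκ0.ne', one_smul, real_inner_smul_left]
  have hint := (integrable_inner_argmax hτ s).const_mul κ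
  have e1 : ∫ c, f (synthesis s c) ∂π
      = κ * ∫ u, ⟪u, s (τ u)⟫ ∂(stdGaussian (EuclideanSpace ℝ (Fin (q - 1)))) := by
    rw [← integral_map (φ := synthesis s) (by fun_prop) hf.aestronglyMeasurable, hmap,
      integral_map (by fun_prop) hf.aestronglyMeasurable, ← integral_const_mul]
    simp only [hfκ]
  have hfint : Integrable (fun c => f (synthesis s c)) π := by
    have : Integrable f (π.map (synthesis s)) := by
      rw [hmap, integrable_map_measure hf.aestronglyMeasurable (by fun_prop)]
      exact hint.congr (.of_forall fun u => (hfκ u).symm)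
    exact this.comp_measurable (by fun_prop)
  have hfge : ∀ c i, c i - (∑ k, c k) / q ≤ f (synthesis s c) := fun c i => by
    rw [← hs.inner_synthesis hq, real_inner_comm]
    have := hmax (κ⁻¹ • synthesis s c) i
    rw [real_inner_smul_left, real_inner_smul_left] at this
    exact le_of_mul_le_mul_left this (inv_pos.2 hκ0)
  have hI0 : 0 ≤ ∫ u, ⟪u, s (τ u)⟫ ∂(stdGaussian (EuclideanSpace ℝ (Fin (q - 1)))) :=
    integral_nonneg fun u => hs.inner_argmax_nonneg hq hmax u
  have hev : ∀ k : Fin q, Integrable (fun c : Fin q → ℝ => c k) π := fun k =>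
    (measurePreserving_eval (fun _ : Fin q => gaussianReal 0 1) k).integrable_comp_of_integrable
      (g := fun a => a) ((memLp_id_gaussianReal 1).integrable (by simp))
  have hev0 : ∀ k : Fin q, ∫ c, c k ∂π = 0 := fun k => by
    rw [integral_comp_eval (μ := fun _ : Fin q => gaussianReal 0 1) (i := k) (f := fun a => a)
      (by fun_prop)]
    exact integral_id_gaussianReal
  have hsq : Integrable (fun a : ℝ => a ^ 2) (gaussianReal 0 1) :=
    (memLp_id_gaussianReal 2).integrable_sq
  have hevsq : Integrable (fun c : Fin q → ℝ => c j ^ 2) π :=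
    (measurePreserving_eval (fun _ : Fin q => gaussianReal 0 1) j).integrable_comp_of_integrable
      (g := fun a => a ^ 2) hsq
  have hevsq1 : ∫ c, c j ^ 2 ∂π = 1 := by
    rw [integral_comp_eval (μ := fun _ : Fin q => gaussianReal 0 1) (i := j) (f := fun a => a ^ 2)
      (by fun_prop)]
    have := variance_of_integral_eq_zero (X := fun a : ℝ => a) (μ := gaussianReal 0 1) (by fun_prop)
      integral_id_gaussianReal
    rw [variance_fun_id_gaussianReal] at this
    exact_mod_cast this.symm
  -- off `A` some score is at least `t`; on `A` the first score bounds the maximum from below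
  have hpt : ∀ c : Fin q → ℝ,
      (t - t * A.indicator 1 c) - ((1 / 2) * c j ^ 2 + 1 / 2) - (1 / q) * ∑ k, c k
        ≤ f (synthesis s c) := by
    intro c
    by_cases hc : c ∈ A
    · rw [Set.indicator_of_mem hc]
      have := hfge c j
      simp only [Pi.one_apply]
      rw [div_eq_inv_mul] at this
      rw [one_div (q : ℝ)]
      nlinarith [sq_nonneg (c j + 1)]
    · rw [Set.indicator_of_notMem hc]
      simp only [A, Set.mem_univ_pi, Set.mem_Iio, not_forall, not_lt] at hc
      obtain ⟨i, hi⟩ := hc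
      have := hfge c i
      rw [div_eq_inv_mul] at this
      rw [one_div (q : ℝ)]
      nlinarith [sq_nonneg (c j)]
  have hi1 : Integrable (fun c => A.indicator (1 : (Fin q → ℝ) → ℝ) c) π :=
    (integrable_const (1 : ℝ)).indicator hA
  have hi2 : Integrable (fun c : Fin q → ℝ => (1 / (q : ℝ)) * ∑ k, c k) π :=
    (integrable_finsetSum _ fun k _ => hev k).const_mul _
  have hi3 : Integrable (fun c : Fin q → ℝ => (1 / 2) * c j ^ 2 + 1 / 2) π :=
    (hevsq.const_mul _).add (integrable_const _)
  have hi4 : Integrable (fun c : Fin q → ℝ => t - t * A.indicator 1 c) π :=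
    (integrable_const _).sub (hi1.const_mul _)
  have hi5 : Integrable
      (fun c : Fin q → ℝ => (t - t * A.indicator 1 c) - ((1 / 2) * c j ^ 2 + 1 / 2)) π :=
    hi4.sub hi3
  have h1 : ∫ c, ((t - t * A.indicator 1 c) - ((1 / 2) * c j ^ 2 + 1 / 2)
      - (1 / q) * ∑ k, c k) ∂π ≤ ∫ c, f (synthesis s c) ∂π :=
    integral_mono (hi5.sub hi2) hfint hpt
  have e2 : ∫ c, A.indicator (1 : (Fin q → ℝ) → ℝ) c ∂π
      = (1 - (gaussianReal 0 1).real (Set.Ici t)) ^ q := by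
    rw [integral_indicator_one hA, measureReal_def, Measure.pi_pi, Finset.prod_const,
      Finset.card_univ, Fintype.card_fin, ENNReal.toReal_pow, ← measureReal_def,
      ← probReal_compl_eq_one_sub measurableSet_Ici, Set.compl_Ici]
  rw [integral_sub hi5 hi2, integral_sub hi4 hi3, integral_sub (integrable_const _)
    (hi1.const_mul _), integral_const_mul, integral_const_mul, e2,
    integral_finsetSum _ (fun k _ => hev k), integral_add (hevsq.const_mul _) (integrable_const _),
    integral_const_mul, hevsq1, e1] at h1
  simp only [hev0, integral_const, probReal_univ, Finset.sum_const_zero, mul_zero, sub_zero,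
    one_smul] at h1
  have h2 : (1 - (gaussianReal 0 1).real (Set.Ici t)) ^ q
      ≤ Real.exp (-(q * (gaussianReal 0 1).real (Set.Ici t))) := by
    rw [show -(q * (gaussianReal 0 1).real (Set.Ici t)) = q * (-(gaussianReal 0 1).real (Set.Ici t))
      by ring, Real.exp_nat_mul]
    exact pow_le_pow_left₀ (sub_nonneg.2 measureReal_le_one) (Real.one_sub_le_exp_neg _) q
  have h3 := mul_le_mul_of_nonneg_left h2 ht
  have h4 := mul_le_mul_of_nonneg_right hκ1 hI0
  linarith

/-- The expected maximal correlation of a standard Gaussian vector with the codewords of a simplex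
code is at least of order `√(log q)`. -/
theorem IsSimplexCode.sqrt_log_le_integral_argmax (hs : IsSimplexCode s) (hq : 2 ≤ q)
    (hτ : Measurable τ) (hmax : ∀ u i, ⟪u, s i⟫ ≤ ⟪u, s (τ u)⟫) :
    1 / 240 * √(Real.log q)
      ≤ ∫ u, ⟪u, s (τ u)⟫ ∂(stdGaussian (EuclideanSpace ℝ (Fin (q - 1)))) := by
  have hq' : (2 : ℝ) ≤ q := by exact_mod_cast hq
  have hlog : 0 ≤ Real.log q := Real.log_nonneg (by linarith)
  set L := √(Real.log q) with hL
  have hL2 : L ^ 2 = Real.log q := Real.sq_sqrt hlog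
  have hL0 : 0 ≤ L := Real.sqrt_nonneg _
  -- for large `q` the comparison with independent variables at level `L / 2` loses only a constant;
  -- for `L ≤ 8` the constant lower bound suffices
  rcases le_total L 8 with h8 | h8
  · have := hs.const_le_integral_argmax hq hτ hmax
    linarith
  · have h1 := hs.le_integral_argmax hq hτ hmax (t := L / 2) (by positivity)
    have h2 := gaussianReal_Ici_ge (t := L / 2) (by positivity)
    have hqe : (q : ℝ) = Real.exp (L ^ 2) := by rw [hL2, Real.exp_log (by linarith)]
    have h3 : 1 ≤ q * (gaussianReal 0 1).real (Set.Ici (L / 2)) := by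
      calc (1 : ℝ) ≤ (1 + 2) / 3 := by norm_num
        _ ≤ Real.exp (L ^ 2 - (L / 2 + 1) ^ 2 / 2) / 3 := by
            have : (2 : ℝ) ≤ L ^ 2 - (L / 2 + 1) ^ 2 / 2 := by nlinarith
            have h := Real.add_one_le_exp (L ^ 2 - (L / 2 + 1) ^ 2 / 2)
            linarith
        _ = q * (Real.exp (-((L / 2 + 1) ^ 2 / 2)) / 3) := by
            rw [hqe, ← mul_div_assoc, ← Real.exp_add, sub_eq_add_neg]
        _ ≤ _ := by gcongr
    have h4 : Real.exp (-(q * (gaussianReal 0 1).real (Set.Ici (L / 2)))) ≤ 1 / 2 := by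
      calc _ ≤ Real.exp (-1) := Real.exp_le_exp.2 (by linarith)
        _ ≤ 1 / 2 := by
          rw [Real.exp_neg, one_div]
          exact inv_anti₀ (by norm_num) (by linarith [Real.add_one_le_exp (1 : ℝ)])
    nlinarith

end GaussianMaximum

/-! ### Two label models -/

section LabelModels

variable {q : ℕ} {s : Fin q → EuclideanSpace ℝ (Fin (q - 1))}
  {τ : EuclideanSpace ℝ (Fin (q - 1)) → Fin q}

lemma integrable_correlation_label {𝒩 : Type*} [MeasurableSpace 𝒩] {N : Measure 𝒩}
    [IsProbabilityMeasure N] {Y : EuclideanSpace ℝ (Fin (q - 1)) × 𝒩 → Fin q} (hY : Measurable Y) :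
    Integrable (fun p => ⟪s (Y p), p.1⟫)
      ((stdGaussian (EuclideanSpace ℝ (Fin (q - 1)))).prod N) :=
  integrable_selection (f := fun j (p : EuclideanSpace ℝ (Fin (q - 1)) × 𝒩) => ⟪s j, p.1⟫) hY
    (fun j => by fun_prop) fun j => by
    simp only [real_inner_comm _ (s j)]
    exact (integrable_inner_stdGaussian (s j)).comp_fst N

lemma IsSimplexCode.integral_exp_neg_argmax_le (hs : IsSimplexCode s) (hτ : Measurable τ)
    (hmax : ∀ u i, ⟪u, s i⟫ ≤ ⟪u, s (τ u)⟫) {θ : ℝ} (hθ : 0 ≤ θ) :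
    ∫ u, Real.exp (-θ * ⟪u, s (τ u)⟫) ∂(stdGaussian (EuclideanSpace ℝ (Fin (q - 1))))
      ≤ Real.exp (θ ^ 2
        - θ * (∫ u, ⟪u, s (τ u)⟫ ∂(stdGaussian (EuclideanSpace ℝ (Fin (q - 1))))) / 2) := by
  have h := QaryCS.integral_exp_neg_argmax_le hτ hmax (fun i => (hs.norm_eq_one i).le)
    (μ := θ / 2) (by positivity)
  rw [show -2 * (θ / 2) = -θ by ring] at h
  refine h.trans (Real.exp_le_exp.2 (le_of_eq ?_))
  ring

/-- The label computed from the scores `⟪s_j, u⟫ + g_j`, in terms of an argmax `τ` for the scores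
without noise. -/
noncomputable def noisyLabel (s : Fin q → EuclideanSpace ℝ (Fin (q - 1)))
    (τ : EuclideanSpace ℝ (Fin (q - 1)) → Fin q)
    (p : EuclideanSpace ℝ (Fin (q - 1)) × (Fin q → ℝ)) : Fin q :=
  τ (p.1 + synthesis s p.2)

/-- The label `τ u` if the Boolean is true and the given random label otherwise. -/
def inexactLabel (τ : EuclideanSpace ℝ (Fin (q - 1)) → Fin q)
    (p : EuclideanSpace ℝ (Fin (q - 1)) × (Bool × Fin q)) : Fin q :=
  if p.2.1 = true then τ p.1 else p.2.2

lemma measurable_noisyLabel (hτ : Measurable τ) : Measurable (noisyLabel s τ) := by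
  unfold noisyLabel; fun_prop

lemma measurable_inexactLabel (hτ : Measurable τ) : Measurable (inexactLabel τ) :=
  Measurable.ite ((measurableSet_singleton true).preimage
    (f := fun p : EuclideanSpace ℝ (Fin (q - 1)) × (Bool × Fin q) => p.2.1) (by fun_prop))
    (by fun_prop) (by fun_prop)

/-- Adding noise to the scores amounts to adding an independent isotropic Gaussian vector `V` to the
signal `U`. Rotating the pair `(U, V)` so that the sum becomes one of the coordinates expresses the
signal as a combination of a vector that determines the label and a vector independent of it. -/
lemma IsSimplexCode.map_noisyLabel (hs : IsSimplexCode s) (hq : 2 ≤ q) (hτ : Measurable τ)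
    (σ : ℝ≥0) {φ r : ℝ} (hφ : φ = Real.arctan ((σ : ℝ) * √(((q : ℝ) - 1) / q)))
    (hr : r = Real.cos φ + (σ : ℝ) * √(((q : ℝ) - 1) / q) * Real.sin φ) :
    ((stdGaussian (EuclideanSpace ℝ (Fin (q - 1)))).prod
        (Measure.pi fun _ : Fin q => gaussianReal 0 (σ ^ 2))).map
        (fun p => ⟪s (noisyLabel s τ p), p.1⟫)
      = ((stdGaussian (EuclideanSpace ℝ (Fin (q - 1)))).prod
          (stdGaussian (EuclideanSpace ℝ (Fin (q - 1))))).map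
        (fun p => Real.cos φ * ⟪p.1, s (τ (r • p.1))⟫ - Real.sin φ * ⟪p.2, s (τ (r • p.1))⟫) := by
  set γ := stdGaussian (EuclideanSpace ℝ (Fin (q - 1)))
  set N := Measure.pi fun _ : Fin q => gaussianReal 0 (σ ^ 2)
  set t := (σ : ℝ) * √(((q : ℝ) - 1) / q) with ht
  let F : EuclideanSpace ℝ (Fin (q - 1)) × EuclideanSpace ℝ (Fin (q - 1)) → ℝ :=
    fun p => ⟪s (τ (p.1 + p.2)), p.1⟫
  have hF : Measurable F := measurable_selection
    (τ := fun p : EuclideanSpace ℝ (Fin (q - 1)) × EuclideanSpace ℝ (Fin (q - 1)) => τ (p.1 + p.2))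
    (f := fun j p => ⟪s j, p.1⟫) (by fun_prop) (fun j => by fun_prop)
  have hN : N.map (synthesis s) = γ.map (t • ·) := hs.map_synthesis hq σ
  let rot := ContinuousLinearMap.rotation (E := EuclideanSpace ℝ (Fin (q - 1))) (-φ)
  have hrot : MeasurePreserving rot (γ.prod γ) (γ.prod γ) := map_rotation_stdGaussian _
  have hsin : t * Real.cos φ = Real.sin φ := by
    rw [hφ, Real.cos_arctan, Real.sin_arctan]; ring
  calc (γ.prod N).map (fun p => ⟪s (noisyLabel s τ p), p.1⟫)
      = ((γ.prod N).map (Prod.map id (synthesis s))).map F := by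
        rw [Measure.map_map hF (by fun_prop)]; rfl
    _ = ((γ.prod γ).map (Prod.map id (t • ·))).map F := by
        rw [← Measure.map_prod_map _ _ measurable_id (by fun_prop), hN,
          Measure.map_prod_map _ _ measurable_id (by fun_prop)]
    _ = (((γ.prod γ).map rot).map (Prod.map id (t • ·))).map F := by rw [hrot.map_eq]
    _ = (γ.prod γ).map (F ∘ (Prod.map id (t • ·)) ∘ rot) := by
        rw [Measure.map_map (by fun_prop) hrot.measurable, Measure.map_map hF (by fun_prop)]
    _ = _ := by
        congr 1
        funext p
        have h1 : (rot p).1 = Real.cos φ • p.1 - Real.sin φ • p.2 := by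
          simp [rot, ContinuousLinearMap.rotation_apply, sub_eq_add_neg]
        have h2 : (rot p).2 = Real.sin φ • p.1 + Real.cos φ • p.2 := by
          simp [rot, ContinuousLinearMap.rotation_apply]
        have h3 : (rot p).1 + t • (rot p).2 = r • p.1 := by
          rw [h1, h2, smul_add, smul_smul, smul_smul, hsin, hr]
          module
        simp only [Function.comp_apply, F, Prod.map_fst, Prod.map_snd, id_eq, h3]
        rw [h1, real_inner_comm, inner_sub_left, real_inner_smul_left, real_inner_smul_left]

/-- Mean and lower exponential moments of the correlation of a label with the signal, in the
presence of noise before quantization. -/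
theorem IsSimplexCode.exists_noisyLabel_bounds (hs : IsSimplexCode s) (hq : 2 ≤ q)
    (hτ : Measurable τ) (hmax : ∀ u i, ⟪u, s i⟫ ≤ ⟪u, s (τ u)⟫) (σ : ℝ≥0) :
    ∃ Λ : ℝ, 1 / 240 * √(Real.log q / (1 + (σ : ℝ) ^ 2)) ≤ Λ ∧
      ∫ p, ⟪s (noisyLabel s τ p), p.1⟫ ∂((stdGaussian (EuclideanSpace ℝ (Fin (q - 1)))).prod
        (Measure.pi fun _ : Fin q => gaussianReal 0 (σ ^ 2))) = Λ ∧
      ∀ θ : ℝ, 0 ≤ θ → ∫ p, Real.exp (-θ * ⟪s (noisyLabel s τ p), p.1⟫)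
        ∂((stdGaussian (EuclideanSpace ℝ (Fin (q - 1)))).prod
          (Measure.pi fun _ : Fin q => gaussianReal 0 (σ ^ 2))) ≤ Real.exp (θ ^ 2 - θ * Λ / 2) := by
  have hq' : (2 : ℝ) ≤ q := by exact_mod_cast hq
  set γ := stdGaussian (EuclideanSpace ℝ (Fin (q - 1)))
  set N := Measure.pi fun _ : Fin q => gaussianReal 0 (σ ^ 2)
  set κ := √(((q : ℝ) - 1) / q) with hκ
  set t := (σ : ℝ) * κ with ht
  have hκ0 : 0 ≤ κ := Real.sqrt_nonneg _
  have hκ1 : κ ≤ 1 := Real.sqrt_le_one.2 ((div_le_one (by linarith)).2 (by linarith))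
  have ht0 : 0 ≤ t := mul_nonneg σ.coe_nonneg hκ0
  set φ := Real.arctan t with hφ
  set r := Real.cos φ + t * Real.sin φ with hr
  have hcos : 0 < Real.cos φ := Real.cos_arctan_pos t
  have hsin : 0 ≤ Real.sin φ := by
    rw [hφ, Real.sin_arctan]; positivity
  have hr0 : 0 < r := by positivity
  have hmapξ := hs.map_noisyLabel hq hτ σ hφ hr
  -- `τ (r • u)` is again a maximizer of the correlation with `u`
  have hτ' : Measurable fun u => τ (r • u) := by fun_prop
  have hmax' : ∀ u i, ⟪u, s i⟫ ≤ ⟪u, s (τ (r • u))⟫ := fun u i => by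
    have := hmax (r • u) i
    rw [real_inner_smul_left, real_inner_smul_left] at this
    exact le_of_mul_le_mul_left this hr0
  set Λ' := ∫ u, ⟪u, s (τ (r • u))⟫ ∂γ with hΛ'
  have hΛ'ge : 1 / 240 * √(Real.log q) ≤ Λ' := hs.sqrt_log_le_integral_argmax hq hτ' hmax'
  have hξm : Measurable fun p : EuclideanSpace ℝ (Fin (q - 1)) × (Fin q → ℝ) =>
      ⟪s (noisyLabel s τ p), p.1⟫ :=
    measurable_selection (measurable_noisyLabel (s := s) hτ) (f := fun j p => ⟪s j, p.1⟫)
      (fun j => by fun_prop)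
  let G : EuclideanSpace ℝ (Fin (q - 1)) × EuclideanSpace ℝ (Fin (q - 1)) → ℝ :=
    fun p => Real.cos φ * ⟪p.1, s (τ (r • p.1))⟫ - Real.sin φ * ⟪p.2, s (τ (r • p.1))⟫
  have hGm : Measurable G := measurable_selection
    (τ := fun p : EuclideanSpace ℝ (Fin (q - 1)) × EuclideanSpace ℝ (Fin (q - 1)) => τ (r • p.1))
    (f := fun j p => Real.cos φ * ⟪p.1, s j⟫ - Real.sin φ * ⟪p.2, s j⟫) (by fun_prop)
    (fun j => by fun_prop)
  have htrans : ∀ f : ℝ → ℝ, Measurable f →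
      ∫ p, f ⟪s (noisyLabel s τ p), p.1⟫ ∂(γ.prod N) = ∫ p, f (G p) ∂(γ.prod γ) := by
    intro f hf
    rw [← integral_map hξm.aemeasurable hf.aestronglyMeasurable, hmapξ,
      integral_map hGm.aemeasurable hf.aestronglyMeasurable]
  refine ⟨Real.cos φ * Λ', ?_, ?_, ?_⟩
  · have h1 : (√(1 + (σ : ℝ) ^ 2))⁻¹ ≤ Real.cos φ := by
      rw [hφ, Real.cos_arctan, one_div]
      apply inv_anti₀ (by positivity)
      apply Real.sqrt_le_sqrt
      have : t ≤ σ := mul_le_of_le_one_right σ.coe_nonneg hκ1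
      gcongr
    rw [Real.sqrt_div' _ (by positivity), div_eq_mul_inv]
    calc 1 / 240 * (√(Real.log q) * (√(1 + (σ : ℝ) ^ 2))⁻¹)
        = (√(1 + (σ : ℝ) ^ 2))⁻¹ * (1 / 240 * √(Real.log q)) := by ring
      _ ≤ Real.cos φ * Λ' := by gcongr
  · rw [htrans (fun a => a) measurable_id]
    have hi1 : Integrable (fun p : EuclideanSpace ℝ (Fin (q - 1)) ×
        EuclideanSpace ℝ (Fin (q - 1)) => ⟪p.1, s (τ (r • p.1))⟫) (γ.prod γ) :=
      (integrable_inner_argmax hτ' s).comp_fst γ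
    have hi2 : Integrable (fun p : EuclideanSpace ℝ (Fin (q - 1)) ×
        EuclideanSpace ℝ (Fin (q - 1)) => ⟪p.2, s (τ (r • p.1))⟫) (γ.prod γ) :=
      integrable_selection (σ := fun p : EuclideanSpace ℝ (Fin (q - 1)) ×
        EuclideanSpace ℝ (Fin (q - 1)) => τ (r • p.1)) (f := fun j p => ⟪p.2, s j⟫) (by fun_prop)
        (fun j => by fun_prop) fun j => (integrable_inner_stdGaussian (s j)).comp_snd γ
    simp only [G]
    rw [integral_sub (hi1.const_mul _) (hi2.const_mul _), integral_const_mul, integral_const_mul,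
      integral_prod _ hi1, integral_prod _ hi2]
    have h0 : ∀ u, ∫ v, ⟪v, s (τ (r • u))⟫ ∂γ = 0 := fun u => integral_inner_stdGaussian _
    simp only [h0]
    simp [hΛ']
  · intro θ hθ
    rw [htrans (fun a => Real.exp (-θ * a)) (by fun_prop)]
    have he : ∀ p, Real.exp (-θ * G p) = Real.exp (-(θ * Real.cos φ) * ⟪p.1, s (τ (r • p.1))⟫)
        * Real.exp (θ * Real.sin φ * ⟪p.2, s (τ (r • p.1))⟫) := fun p => by
      rw [← Real.exp_add]; congr 1; simp only [G]; ring
    have hi : Integrable (fun p : EuclideanSpace ℝ (Fin (q - 1)) × EuclideanSpace ℝ (Fin (q - 1)) =>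
        Real.exp (-(θ * Real.cos φ) * ⟪p.1, s (τ (r • p.1))⟫)
        * Real.exp (θ * Real.sin φ * ⟪p.2, s (τ (r • p.1))⟫)) (γ.prod γ) :=
      integrable_selection (σ := fun p : EuclideanSpace ℝ (Fin (q - 1)) ×
        EuclideanSpace ℝ (Fin (q - 1)) => τ (r • p.1))
        (f := fun j p => Real.exp (-(θ * Real.cos φ) * ⟪p.1, s j⟫)
          * Real.exp (θ * Real.sin φ * ⟪p.2, s j⟫)) (by fun_prop) (fun j => by fun_prop)
        fun j => (integrable_exp_inner_stdGaussian _ (s j)).mul_prod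
          (integrable_exp_inner_stdGaussian _ (s j))
    simp only [he]
    rw [integral_prod _ hi]
    simp only [integral_const_mul, integral_exp_inner_stdGaussian, hs.norm_eq_one, γ]
    rw [integral_mul_const]
    have h1 := hs.integral_exp_neg_argmax_le hτ' hmax' (θ := θ * Real.cos φ) (by positivity)
    refine (mul_le_mul_of_nonneg_right h1 (Real.exp_pos _).le).trans ?_
    rw [← Real.exp_add]
    apply Real.exp_le_exp.2
    have h2 := Real.cos_sq_add_sin_sq φ
    have h3 : (θ * Real.cos φ) ^ 2 + (θ * Real.sin φ) ^ 2 = θ ^ 2 := by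
      rw [mul_pow, mul_pow, ← mul_add, h2, mul_one]
    have h4 : θ * Real.cos φ * Λ' / 2 = θ * (Real.cos φ * Λ') / 2 := by ring
    nlinarith [sq_nonneg (θ * Real.sin φ)]

/-- Mean and lower exponential moments of the correlation of a label with the signal, when the
maximum is inexact. -/
theorem IsSimplexCode.exists_inexactLabel_bounds (hs : IsSimplexCode s) (hq : 2 ≤ q)
    (hτ : Measurable τ) (hmax : ∀ u i, ⟪u, s i⟫ ≤ ⟪u, s (τ u)⟫) (p : unitInterval) :
    ∃ Λ : ℝ, 1 / 240 * √(Real.log q) ≤ Λ ∧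
      ∫ z, ⟪s (inexactLabel τ z), z.1⟫ ∂((stdGaussian (EuclideanSpace ℝ (Fin (q - 1)))).prod
        ((bernoulliMeasure true false p).prod (uniformOn (Set.univ : Set (Fin q))))) = p * Λ ∧
      ∀ θ : ℝ, 0 ≤ θ → ∫ z, Real.exp (-θ * ⟪s (inexactLabel τ z), z.1⟫)
        ∂((stdGaussian (EuclideanSpace ℝ (Fin (q - 1)))).prod
          ((bernoulliMeasure true false p).prod (uniformOn (Set.univ : Set (Fin q)))))
        ≤ p * Real.exp (θ ^ 2 - θ * Λ / 2) + (1 - p) * Real.exp (θ ^ 2 / 2) := by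
  have : Nonempty (Fin q) := ⟨⟨0, by omega⟩⟩
  set γ := stdGaussian (EuclideanSpace ℝ (Fin (q - 1)))
  set u := uniformOn (Set.univ : Set (Fin q))
  set N := (bernoulliMeasure true false p).prod u
  have key : ∀ (f : ℝ → ℝ) (a b : ℝ),
      Integrable (fun z => f ⟪s (inexactLabel τ z), z.1⟫) (γ.prod N) →
      ∫ v, f ⟪s (τ v), v⟫ ∂γ = a → (∀ j, ∫ v, f ⟪s j, v⟫ ∂γ = b) →
      ∫ z, f ⟪s (inexactLabel τ z), z.1⟫ ∂(γ.prod N) = p * a + (1 - p) * b := by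
    intro f a b hf ha hb
    rw [integral_prod_symm _ hf]
    have h1 : ∀ ν : Bool × Fin q, ∫ v, f ⟪s (inexactLabel τ (v, ν)), v⟫ ∂γ
        = if ν.1 = true then a else b := by
      rintro ⟨β, j⟩
      cases β
      · simpa [inexactLabel] using hb j
      · simpa [inexactLabel] using ha
    simp only [h1]
    rw [integral_prod _ (Integrable.of_finite)]
    simp [integral_bernoulliMeasure]
  have hY := measurable_inexactLabel hτ
  refine ⟨∫ v, ⟪v, s (τ v)⟫ ∂γ, hs.sqrt_log_le_integral_argmax hq hτ hmax, ?_, fun θ hθ => ?_⟩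
  · rw [key (fun a => a) (∫ v, ⟪v, s (τ v)⟫ ∂γ) 0 (integrable_correlation_label hY)
      (by simp only [real_inner_comm]) (fun j => by
        simp only [real_inner_comm _ (s j)]; exact integral_inner_stdGaussian (s j))]
    ring
  · rw [key (fun a => Real.exp (-θ * a)) (∫ v, Real.exp (-θ * ⟪v, s (τ v)⟫) ∂γ)
      (Real.exp (θ ^ 2 / 2)) (integrable_exp_correlation_label hY (-θ))
      (by simp only [real_inner_comm]) (fun j => by
        simp only [real_inner_comm _ (s j)]
        rw [integral_exp_inner_stdGaussian, hs.norm_eq_one]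
        congr 1; ring)]
    have := hs.integral_exp_neg_argmax_le hτ hmax hθ
    have hp := p.2.1
    gcongr

end LabelModels

/-! ### Recovery for the two label models -/

section Assembly

variable {Ω : Type*} [MeasurableSpace Ω] {P : Measure Ω} {q d m : ℕ}
  {s : Fin q → EuclideanSpace ℝ (Fin (q - 1))} {K : Set (EuclideanSpace ℝ (Fin d))}
  {x : EuclideanSpace ℝ (Fin d)} {W : Fin m → Ω → Fin (q - 1) → Fin d → ℝ} {y : Fin m → Ω → Fin q}
  {𝒩 : Type*} [MeasurableSpace 𝒩] {N : Measure 𝒩} [IsProbabilityMeasure N] {ν : Fin m → Ω → 𝒩}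
  {Y : EuclideanSpace ℝ (Fin (q - 1)) × 𝒩 → Fin q}

lemma hasLaw_signal (hx : ‖x‖ = 1)
    (hlaw : HasLaw (fun ω i => (W i ω, ν i ω))
      (Measure.pi fun _ : Fin m => (gaussianMatrix (q - 1) d).prod N) P) (i : Fin m) :
    HasLaw (fun ω => (matVec (W i ω) x, ν i ω))
      ((stdGaussian (EuclideanSpace ℝ (Fin (q - 1)))).prod N) P :=
  (measurePreserving_matVec_prod hx N).fun_comp_hasLaw
    ((measurePreserving_eval (fun _ : Fin m => (gaussianMatrix (q - 1) d).prod N) i).fun_comp_hasLaw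
      hlaw)

lemma integral_correlation_label (hx : ‖x‖ = 1)
    (hlaw : HasLaw (fun ω i => (W i ω, ν i ω))
      (Measure.pi fun _ : Fin m => (gaussianMatrix (q - 1) d).prod N) P)
    (hY : Measurable Y) (hy : ∀ᵐ ω ∂P, ∀ i, y i ω = Y (matVec (W i ω) x, ν i ω)) (i : Fin m) :
    Integrable (fun ω => correlation s (W i ω) (y i ω) x) P ∧
      ∫ ω, correlation s (W i ω) (y i ω) x ∂P
        = ∫ p, ⟪s (Y p), p.1⟫ ∂((stdGaussian (EuclideanSpace ℝ (Fin (q - 1)))).prod N) := by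
  have hl := hasLaw_signal hx hlaw i
  have hi := integrable_correlation_label (s := s) (N := N) hY
  have hae : (fun ω => correlation s (W i ω) (y i ω) x)
      =ᵐ[P] (fun p => ⟪s (Y p), p.1⟫) ∘ (fun ω => (matVec (W i ω) x, ν i ω)) := by
    filter_upwards [hy] with ω hω
    rw [hω i]
    rfl
  refine ⟨?_, ?_⟩
  · rw [integrable_congr hae, ← integrable_map_measure
      (by rw [hl.map_eq]; exact hi.aestronglyMeasurable) hl.aemeasurable, hl.map_eq]
    exact hi
  · rw [integral_congr_ae hae]
    exact hl.integral_comp hi.aestronglyMeasurable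

/-- Two scores of different labels almost surely differ, whatever independent noise is added to them. -/
lemma IsSimplexCode.ae_score_ne (hs : IsSimplexCode s) (hq : 2 ≤ q) {a : Fin q → 𝒩 → ℝ}
    (ha : ∀ j, Measurable (a j)) :
    ∀ᵐ p ∂((stdGaussian (EuclideanSpace ℝ (Fin (q - 1)))).prod N), ∀ j k, j ≠ k →
      ⟪s j, p.1⟫ + a j p.2 ≠ ⟪s k, p.1⟫ + a k p.2 := by
  have hq' : (2 : ℝ) ≤ q := by exact_mod_cast hq
  rw [ae_all_iff]; intro j
  rw [ae_all_iff]; intro k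
  by_cases hjk : j = k
  · exact .of_forall fun p h => absurd hjk h
  have hA : MeasurableSet {p : EuclideanSpace ℝ (Fin (q - 1)) × 𝒩 |
      ⟪s j, p.1⟫ + a j p.2 = ⟪s k, p.1⟫ + a k p.2} :=
    measurableSet_eq_fun (by fun_prop) (by fun_prop)
  have hne : s j - s k ≠ 0 := by
    intro h
    rw [sub_eq_zero] at h
    have h1 := hs.inner_eq k j (Ne.symm hjk)
    rw [h, real_inner_self_eq_norm_sq, hs.norm_sq_eq] at h1
    have : 0 < 1 / ((q : ℝ) - 1) := one_div_pos.2 (by linarith)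
    linarith
  have h0 : ((stdGaussian (EuclideanSpace ℝ (Fin (q - 1)))).prod N)
      {p | ⟪s j, p.1⟫ + a j p.2 = ⟪s k, p.1⟫ + a k p.2} = 0 := by
    rw [Measure.prod_apply_symm hA, lintegral_eq_zero_iff (measurable_measure_prodMk_right hA)]
    refine .of_forall fun ν => ?_
    have hset : (fun u => (u, ν)) ⁻¹' {p : EuclideanSpace ℝ (Fin (q - 1)) × 𝒩 |
        ⟪s j, p.1⟫ + a j p.2 = ⟪s k, p.1⟫ + a k p.2}
        = (fun u => ⟪u, s j - s k⟫) ⁻¹' {a k ν - a j ν} := by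
      ext u
      simp only [Set.mem_preimage, Set.mem_ofPred_eq, Set.mem_singleton_iff, inner_sub_right,
        real_inner_comm u]
      constructor <;> intro h <;> linarith
    have hv : ‖s j - s k‖₊ ^ 2 ≠ 0 := pow_ne_zero 2 (nnnorm_ne_zero_iff.2 hne)
    have := nullSingletonClass_gaussianReal (μ := 0) hv
    beta_reduce
    rw [hset, ← Measure.map_apply (by fun_prop) (measurableSet_singleton _), map_inner_stdGaussian]
    exact measure_singleton _
  filter_upwards [compl_mem_ae_iff.2 h0] with p hp _
  exact hp

/-- The lower bound on the number of samples, solved for the mean width, which it forces to be finite. -/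
lemma meanWidth_le_of_sample_size {a δ : ℝ} (ha : 0 < a) (hδ : 0 < δ)
    (h : ENNReal.ofReal (a ^ 2 / δ ^ 2) * meanWidth K ^ 2 ≤ (m : ℝ≥0∞)) :
    meanWidth K ≤ ENNReal.ofReal (δ * √m / a) := by
  have hpos : 0 < a ^ 2 / δ ^ 2 := by positivity
  have hfin : meanWidth K ≠ ∞ := by
    intro htop
    rw [htop, ENNReal.top_pow two_ne_zero, ENNReal.mul_top (ENNReal.ofReal_pos.2 hpos).ne'] at h
    exact absurd h (by simp)
  lift meanWidth K to ℝ≥0 using hfin with w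
  rw [← ENNReal.ofReal_coe_nnreal, ← ENNReal.ofReal_pow w.coe_nonneg, ← ENNReal.ofReal_mul hpos.le,
    ← ENNReal.ofReal_natCast, ENNReal.ofReal_le_ofReal_iff (by positivity)] at h
  rw [← ENNReal.ofReal_coe_nnreal]
  apply ENNReal.ofReal_le_ofReal
  rw [le_div_iff₀ ha]
  apply abs_le_of_sq_le_sq' _ (by positivity) |>.2
  rw [mul_pow δ, Real.sq_sqrt (by positivity)]
  calc ((w : ℝ) * a) ^ 2 = δ ^ 2 * (a ^ 2 / δ ^ 2 * (w : ℝ) ^ 2) := by field_simp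
    _ ≤ δ ^ 2 * m := by gcongr

/-- The labels are almost surely determined by the signals and the noise, since ties have probability
zero. -/
lemma NoiseBeforeQuantization.ae_label_eq {σ : ℝ≥0} {g : Fin m → Ω → Fin q → ℝ}
    (h : NoiseBeforeQuantization s x σ P W g y) (hs : IsSimplexCode s) (hq : 2 ≤ q) (hx : ‖x‖ = 1)
    {τ : EuclideanSpace ℝ (Fin (q - 1)) → Fin q} (hmax : ∀ u i, ⟪u, s i⟫ ≤ ⟪u, s (τ u)⟫) :
    ∀ᵐ ω ∂P, ∀ i, y i ω = noisyLabel s τ (matVec (W i ω) x, g i ω) := by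
  have hne : ∀ᵐ ω ∂P, ∀ i, ∀ j k, j ≠ k →
      ⟪s j, matVec (W i ω) x⟫ + g i ω j ≠ ⟪s k, matVec (W i ω) x⟫ + g i ω k :=
    ae_all_iff.2 fun i => by
      have hl := hasLaw_signal hx h.law i
      have := hs.ae_score_ne (N := Measure.pi fun _ : Fin q => gaussianReal 0 (σ ^ 2)) hq
        (a := fun j g => g j) (fun j => by fun_prop)
      rw [← hl.map_eq] at this
      exact ae_of_ae_map hl.aemeasurable this
  filter_upwards [h.label, hne] with ω hω hneω i
  by_contra hcon
  refine hneω i _ _ hcon (le_antisymm ?_ (hω i _))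
  have := hmax (matVec (W i ω) x + synthesis s (g i ω)) (y i ω)
  rw [inner_add_left, inner_add_left, real_inner_comm, real_inner_comm (s (y i ω)) (synthesis s _),
    real_inner_comm (s (τ _)), real_inner_comm (s (τ _)) (synthesis s _),
    hs.inner_synthesis hq, hs.inner_synthesis hq] at this
  simp only [noisyLabel]
  linarith

lemma InexactMaximum.ae_label_eq {p : unitInterval} {b : Fin m → Ω → Bool} {r : Fin m → Ω → Fin q}
    (h : InexactMaximum s x p P W b r y) (hs : IsSimplexCode s) (hq : 2 ≤ q) (hx : ‖x‖ = 1)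
    {τ : EuclideanSpace ℝ (Fin (q - 1)) → Fin q} (hmax : ∀ u i, ⟪u, s i⟫ ≤ ⟪u, s (τ u)⟫) :
    ∀ᵐ ω ∂P, ∀ i, y i ω = inexactLabel τ (matVec (W i ω) x, (b i ω, r i ω)) := by
  have : Nonempty (Fin q) := ⟨⟨0, by omega⟩⟩
  have hne : ∀ᵐ ω ∂P, ∀ i, ∀ j k, j ≠ k →
      ⟪s j, matVec (W i ω) x⟫ ≠ ⟪s k, matVec (W i ω) x⟫ :=
    ae_all_iff.2 fun i => by
      have hl := hasLaw_signal (ν := fun i ω => (b i ω, r i ω)) hx h.law i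
      have := hs.ae_score_ne (N := (bernoulliMeasure true false p).prod
        (uniformOn (Set.univ : Set (Fin q)))) hq (a := fun _ _ => 0) (fun j => by fun_prop)
      rw [← hl.map_eq] at this
      simpa using ae_of_ae_map hl.aemeasurable this
  filter_upwards [h.label, hne] with ω hω hneω i
  simp only [inexactLabel]
  split_ifs with hb
  · by_contra hcon
    refine hneω i _ _ hcon (le_antisymm ?_ ((hω i).1 hb _))
    have := hmax (matVec (W i ω) x) (y i ω)
    rwa [real_inner_comm, real_inner_comm (s (τ _))] at this
  · exact (hω i).2 (by simpa using hb)

variable [IsProbabilityMeasure P]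

lemma recoversWithin_of_one_le {ε η : ℝ} (hη : 1 ≤ η) : RecoversWithin s K x P W y ε η :=
  recoversWithin_of_measure_le (by linarith)
    (prob_le_one.trans (by rw [← ENNReal.ofReal_one]; exact ENNReal.ofReal_le_ofReal hη))

lemma log_pos_of_two_le (hq : 2 ≤ q) : 1 / 4 ≤ Real.log q := by
  have hq' : (2 : ℝ) ≤ q := by exact_mod_cast hq
  have := Real.log_le_log (by norm_num) hq'
  linarith [Real.log_two_gt_d9]

/-- With `Λ` the mean correlation of an exact label, this bounds the factor contributed by each
sample to the Chernoff bound for the event that the average correlation is at most `Λ / 32`. Since `θ` is a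
small multiple of `1 / Λ`, the decay of order `θ * Λ` from the exact labels, whose weight `p` is at
least `1 / 2`, outweighs the growth of order `θ ^ 2` from the random ones. -/
lemma exp_mul_mixture_le {p Λ Λ₀ θ : ℝ} (hp : 1 / 2 ≤ p) (hp1 : p ≤ 1) (hΛ₀ : 0 < Λ₀)
    (hΛ₀1 : Λ₀ ≤ 1) (hΛ : Λ₀ ≤ Λ) (hθ : θ = Λ₀ ^ 2 / 8 / Λ) :
    Real.exp (θ * (Λ / 32)) * (p * Real.exp (θ ^ 2 - θ * Λ / 2) + (1 - p) * Real.exp (θ ^ 2 / 2))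
      ≤ Real.exp (-(Λ₀ ^ 2 / 256)) := by
  have hΛpos : 0 < Λ := hΛ₀.trans_le hΛ
  set κ := Λ₀ ^ 2 / 8 with hκ
  have hκ0 : 0 < κ := by positivity
  have hκ1 : κ ≤ 1 / 8 := by nlinarith
  have h1 : θ * Λ = κ := by rw [hθ]; field_simp
  have h2 : θ ^ 2 ≤ κ / 8 := by
    rw [hθ, div_pow, div_le_iff₀ (by positivity)]
    have : Λ₀ ^ 2 ≤ Λ ^ 2 := by gcongr
    have h8 : κ * 8 = Λ₀ ^ 2 := by rw [hκ]; ring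
    nlinarith
  have hA : Real.exp (θ ^ 2 - θ * Λ / 2) ≤ 1 - κ / 4 := by
    have h3 : Real.exp (θ ^ 2 - θ * Λ / 2) ≤ Real.exp (-(3 * κ / 8)) :=
      Real.exp_le_exp.2 (by rw [h1]; linarith)
    refine h3.trans ?_
    rw [Real.exp_neg]
    have h4 := Real.add_one_le_exp (3 * κ / 8)
    refine (inv_anti₀ (by positivity) h4).trans ?_
    rw [inv_le_iff_one_le_mul₀ (by positivity)]
    nlinarith
  have hB : Real.exp (θ ^ 2 / 2) ≤ 1 + κ / 8 := by
    have h3 : Real.exp (θ ^ 2 / 2) ≤ Real.exp (κ / 16) := Real.exp_le_exp.2 (by linarith)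
    refine h3.trans ?_
    have h4 := Real.one_sub_le_exp_neg (κ / 16)
    rw [Real.exp_neg] at h4
    have h5 : Real.exp (κ / 16) ≤ (1 - κ / 16)⁻¹ := by
      rw [le_inv_comm₀ (Real.exp_pos _) (by linarith)]; exact h4
    refine h5.trans ?_
    rw [inv_le_iff_one_le_mul₀ (by linarith)]
    nlinarith
  have hM : p * Real.exp (θ ^ 2 - θ * Λ / 2) + (1 - p) * Real.exp (θ ^ 2 / 2) ≤ 1 - κ / 16 := by
    have h6 := mul_le_mul_of_nonneg_left hA (by linarith : 0 ≤ p)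
    have h7 := mul_le_mul_of_nonneg_left hB (by linarith : 0 ≤ 1 - p)
    nlinarith
  calc _ ≤ Real.exp (κ / 32) * Real.exp (-(κ / 16)) := by
        have e : θ * (Λ / 32) = κ / 32 := by rw [← h1]; ring
        rw [e]
        gcongr
        exact hM.trans (Real.one_sub_le_exp_neg _)
    _ = Real.exp (-(Λ₀ ^ 2 / 256)) := by
        rw [← Real.exp_add]; congr 1; rw [hκ]; ring

theorem NoiseBeforeQuantization.recovers {σ : ℝ≥0} {g : Fin m → Ω → Fin q → ℝ}
    (h : NoiseBeforeQuantization s x σ P W g y) (hs : IsSimplexCode s) (hq : 2 ≤ q) (hxK : x ∈ K)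
    (hx : ‖x‖ = 1) :
    (∀ i, Integrable (fun ω => correlation s (W i ω) (y i ω) x) P ∧
      1 / 240 * √(Real.log q / (1 + (σ : ℝ) ^ 2)) ≤ ∫ ω, correlation s (W i ω) (y i ω) x ∂P) ∧
    ∀ δ : ℝ, 0 < δ → ENNReal.ofReal (61440 ^ 2 / δ ^ 2) * meanWidth K ^ 2 ≤ (m : ℝ≥0∞) →
      RecoversWithin s K x P W y (δ * √(1 + (σ : ℝ) ^ 2) / √(Real.log q))
        (8 * Real.exp (-((1 / 240) ^ 2 / 2 ^ 22 * δ ^ 2 * m))) := by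
  have : Nonempty (Fin q) := ⟨⟨0, by omega⟩⟩
  obtain ⟨τ, hτ, hmax⟩ := exists_measurable_argmax
    (φ := fun (i : Fin q) (u : EuclideanSpace ℝ (Fin (q - 1))) => ⟪u, s i⟫) (fun i => by fun_prop)
  have hy := h.ae_label_eq hs hq hx hmax
  have hY : Measurable (noisyLabel s τ) := measurable_noisyLabel hτ
  obtain ⟨Λ, hΛ, hmean, hmgf⟩ := hs.exists_noisyLabel_bounds hq hτ hmax σ
  refine ⟨fun i => ?_, fun δ hδ hm => ?_⟩
  · obtain ⟨h1, h2⟩ := integral_correlation_label (s := s) hx h.law hY hy i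
    exact ⟨h1, by rw [h2, hmean]; exact hΛ⟩
  rcases Nat.eq_zero_or_pos m with rfl | hm0
  · exact recoversWithin_of_one_le (by simp)
  have hm0' : (0 : ℝ) < m := by exact_mod_cast hm0
  set L := √(Real.log q) with hL
  have hL0 : 0 < L := Real.sqrt_pos.2 (by linarith [log_pos_of_two_le hq])
  set D := √(1 + (σ : ℝ) ^ 2) with hD
  have hD0 : 0 < D := Real.sqrt_pos.2 (by positivity)
  set ε := δ * D / L with hε
  have hε0 : 0 < ε := by positivity
  rcases le_or_gt 4 ε with h4 | h4
  · exact recoversWithin_of_four_le hx h4 (by positivity)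
  have hΛ' : 1 / 240 * (L / D) ≤ Λ := by
    rwa [Real.sqrt_div' _ (by positivity)] at hΛ
  have hεΛ : 1 / 240 * δ ≤ ε * Λ := by
    calc 1 / 240 * δ = ε * (1 / 240 * (L / D)) := by rw [hε]; field_simp
      _ ≤ ε * Λ := by gcongr
  have hΛ0 : 0 < Λ := lt_of_lt_of_le (by positivity) hΛ'
  have hΛδ : 1 / 240 * δ / 4 ≤ Λ := by nlinarith
  have hsm : √(m : ℝ) ^ 2 = m := Real.sq_sqrt hm0'.le
  -- `θ = Λ / 8` minimizes the exponent `θ * ρ + θ ^ 2 - θ * Λ / 2` of the Chernoff bound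
  refine recoversWithin_of_label hm0 hs.norm_eq_one hxK hx h.law hY hy hε0.le
    (ρ := Λ / 4) (θ := Λ / 8) (by positivity) (by positivity) ?_ (hmgf _ (by positivity)) ?_
  · refine (meanWidth_le_of_sample_size (by norm_num) hδ hm).trans (ENNReal.ofReal_le_ofReal ?_)
    have := mul_le_mul_of_nonneg_right hεΛ (Real.sqrt_nonneg (m : ℝ))
    have h0 : 0 ≤ δ * √(m : ℝ) := by positivity
    linarith
  · set X := Real.exp (-((1 / 240) ^ 2 / 2 ^ 22 * δ ^ 2 * m)) with hX
    have b1 : (Real.exp (Λ / 8 * (Λ / 4)) * Real.exp ((Λ / 8) ^ 2 - Λ / 8 * Λ / 2)) ^ m ≤ X := by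
      rw [← Real.exp_add, ← Real.exp_nat_mul]
      apply Real.exp_le_exp.2
      have h1 : (1 / 240 * δ / 4) ^ 2 ≤ Λ ^ 2 := by gcongr
      have h2 := mul_le_mul_of_nonneg_left h1 hm0'.le
      have h0 : 0 ≤ m * δ ^ 2 := by positivity
      nlinarith
    have b2 : Real.exp (-((ε * (Λ / 4) * √m / 2) ^ 2 / 256)) ≤ X := by
      apply Real.exp_le_exp.2
      have h1 : (1 / 240 * δ) ^ 2 ≤ (ε * Λ) ^ 2 := by gcongr
      have h2 := mul_le_mul_of_nonneg_left h1 hm0'.le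
      have h3 : (ε * (Λ / 4) * √m / 2) ^ 2 = m * (ε * Λ) ^ 2 / 64 := by
        rw [div_pow, mul_pow _ (√_), hsm]; ring
      have h0 : 0 ≤ m * δ ^ 2 := by positivity
      rw [h3]
      nlinarith
    have : 0 < X := Real.exp_pos _
    linarith

theorem InexactMaximum.recovers {p : unitInterval} {b : Fin m → Ω → Bool} {r : Fin m → Ω → Fin q}
    (h : InexactMaximum s x p P W b r y) (hp : 1 / 2 < (p : ℝ)) (hs : IsSimplexCode s) (hq : 2 ≤ q)
    (hxK : x ∈ K) (hx : ‖x‖ = 1) :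
    (∀ i, Integrable (fun ω => correlation s (W i ω) (y i ω) x) P ∧
      1 / 240 * (2 * (p : ℝ) - 1) * √(Real.log q) ≤ ∫ ω, correlation s (W i ω) (y i ω) x ∂P) ∧
    ∀ δ : ℝ, 0 < δ → ENNReal.ofReal (61440 ^ 2 / δ ^ 2) * meanWidth K ^ 2 ≤ (m : ℝ≥0∞) →
      (δ ≤ 1 → RecoversWithin s K x P W y (δ / (√(Real.log q) * (2 * (p : ℝ) - 1)))
        (8 * Real.exp (-((1 / 240) ^ 2 / 2 ^ 22 * δ ^ 2 * m)))) ∧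
      RecoversWithin s K x P W y (δ / (√(Real.log q) * (2 * (p : ℝ) - 1)))
        (8 * Real.exp (-((1 / 240) ^ 2 / 2 ^ 22 / Real.log q * δ ^ 2 * m))) := by
  have : Nonempty (Fin q) := ⟨⟨0, by omega⟩⟩
  have hp1 : (p : ℝ) ≤ 1 := p.2.2
  obtain ⟨τ, hτ, hmax⟩ := exists_measurable_argmax
    (φ := fun (i : Fin q) (u : EuclideanSpace ℝ (Fin (q - 1))) => ⟪u, s i⟫) (fun i => by fun_prop)
  have hy := h.ae_label_eq hs hq hx hmax
  have hY : Measurable (inexactLabel τ) := measurable_inexactLabel hτ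
  obtain ⟨Λ, hΛ, hmean, hmgf⟩ := hs.exists_inexactLabel_bounds hq hτ hmax p
  have hlog := log_pos_of_two_le hq
  set L := √(Real.log q) with hL
  have hL2 : L ^ 2 = Real.log q := Real.sq_sqrt (by linarith)
  have hLhalf : 1 / 2 ≤ L := by
    rw [hL]; apply Real.le_sqrt_of_sq_le; linarith
  refine ⟨fun i => ?_, fun δ hδ hm => ?_⟩
  · obtain ⟨h1, h2⟩ := integral_correlation_label (s := s) (ν := fun i ω => (b i ω, r i ω))
      hx h.law hY hy i
    refine ⟨h1, ?_⟩
    rw [h2, hmean]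
    calc 1 / 240 * (2 * (p : ℝ) - 1) * L = (2 * (p : ℝ) - 1) * (1 / 240 * L) := by ring
      _ ≤ p * Λ := by
        apply mul_le_mul (by linarith) hΛ (by positivity) (by linarith)
  set ε := δ / (L * (2 * (p : ℝ) - 1)) with hε
  have h2p : 0 < 2 * (p : ℝ) - 1 := by linarith
  have hε0 : 0 < ε := by positivity
  have hsm : √(m : ℝ) ^ 2 = m := Real.sq_sqrt (by positivity)
  have hεΛ : 1 / 240 * δ ≤ ε * Λ := by
    have h1 : δ ≤ ε * L := by
      rw [hε, div_mul_eq_mul_div, le_div_iff₀ (by positivity)]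
      have : L * (2 * (p : ℝ) - 1) ≤ L * 1 := by gcongr; linarith
      nlinarith
    calc 1 / 240 * δ ≤ 1 / 240 * (ε * L) := by gcongr
      _ = ε * (1 / 240 * L) := by ring
      _ ≤ ε * Λ := by gcongr
  -- the average correlation is small with probability at most `exp (-c * m)` for a constant `c`, which
  -- is enough for both rates because `δ ^ 2` is at most `16 * log q` unless the error bound is trivial
  have key : ∀ c' : ℝ, 0 ≤ c' → c' ≤ (1 / 240) ^ 2 / 2 ^ 20 →
      (ε < 4 → c' * δ ^ 2 ≤ (1 / 480) ^ 2 / 256) →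
      RecoversWithin s K x P W y ε (8 * Real.exp (-(c' * δ ^ 2 * m))) := by
    intro c' hc'0 hc' hc'δ
    rcases Nat.eq_zero_or_pos m with rfl | hm0
    · exact recoversWithin_of_one_le (by simp)
    have hm0' : (0 : ℝ) < m := by exact_mod_cast hm0
    rcases le_or_gt 4 ε with h4 | h4
    · exact recoversWithin_of_four_le hx h4 (by positivity)
    have hΛ₀ : 1 / 480 ≤ Λ := by linarith
    have hΛ0 : 0 < Λ := by linarith
    refine recoversWithin_of_label (ν := fun i ω => (b i ω, r i ω)) hm0 hs.norm_eq_one hxK hx h.law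
      hY hy hε0.le (ρ := Λ / 32) (θ := (1 / 480) ^ 2 / 8 / Λ) (by positivity) (by positivity) ?_
      (hmgf _ (by positivity)) ?_
    · refine (meanWidth_le_of_sample_size (by norm_num) hδ hm).trans (ENNReal.ofReal_le_ofReal ?_)
      have := mul_le_mul_of_nonneg_right hεΛ (Real.sqrt_nonneg (m : ℝ))
      linarith
    · set X := Real.exp (-(c' * δ ^ 2 * m)) with hX
      have hmix := exp_mul_mixture_le hp.le hp1 (by norm_num) (by norm_num) hΛ₀ rfl
      have b1 := pow_le_pow_left₀ (add_nonneg (mul_nonneg (by linarith) (Real.exp_pos _).le)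
        (mul_nonneg (by linarith) (Real.exp_pos _).le) |> mul_nonneg (Real.exp_pos _).le) hmix m
      have b1' : Real.exp (-((1 / 480 : ℝ) ^ 2 / 256)) ^ m ≤ X := by
        rw [← Real.exp_nat_mul]
        apply Real.exp_le_exp.2
        have := mul_le_mul_of_nonneg_right (hc'δ h4) hm0'.le
        linarith
      have b2 : Real.exp (-((ε * (Λ / 32) * √m / 2) ^ 2 / 256)) ≤ X := by
        apply Real.exp_le_exp.2
        have h1 : (1 / 240 * δ) ^ 2 ≤ (ε * Λ) ^ 2 := by gcongr
        have h2 := mul_le_mul_of_nonneg_left h1 hm0'.le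
        have h3 : (ε * (Λ / 32) * √m / 2) ^ 2 = m * (ε * Λ) ^ 2 / 4096 := by
          rw [div_pow, mul_pow _ (√_), hsm]; ring
        have h0 : 0 ≤ m * δ ^ 2 := by positivity
        have h5 := mul_le_mul_of_nonneg_right hc' h0
        rw [h3]
        linarith
      have : 0 < X := Real.exp_pos _
      linarith
  refine ⟨fun hδ1 => key _ (by positivity) (by norm_num) fun _ => ?_,
    key _ (by positivity) ?_ fun h4 => ?_⟩
  · have : δ ^ 2 ≤ 1 := by nlinarith
    linarith
  · rw [div_le_iff₀ (by linarith)]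
    linarith
  · have h1 : δ ≤ 4 * L := by
      rw [hε, div_lt_iff₀ (by positivity)] at h4
      have : L * (2 * (p : ℝ) - 1) ≤ L * 1 := by gcongr; linarith
      linarith
    have h2 : δ ^ 2 ≤ 16 * Real.log q := by rw [← hL2]; nlinarith
    rw [div_mul_eq_mul_div, div_le_iff₀ (by linarith)]
    linarith

end Assembly
end QaryCS

theorem mainTheorem3 :
    ∃ C c c₀ : ℝ, 0 < C ∧ 0 < c ∧ 0 < c₀ ∧
      ∀ (q d m : ℕ) (s : Fin q → EuclideanSpace ℝ (Fin (q - 1)))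
        (K : Set (EuclideanSpace ℝ (Fin d))) (x : EuclideanSpace ℝ (Fin d))
        (Ω : Type*) [MeasurableSpace Ω] (P : Measure Ω) [IsProbabilityMeasure P]
        (W : Fin m → Ω → Fin (q - 1) → Fin d → ℝ) (y : Fin m → Ω → Fin q),
        2 ≤ q → QaryCS.IsSimplexCode s → x ∈ K → ‖x‖ = 1 →
        -- noise before quantization
        (∀ (σ : ℝ≥0) (g : Fin m → Ω → Fin q → ℝ),
          QaryCS.NoiseBeforeQuantization s x σ P W g y →
          (∀ i, Integrable (fun ω => QaryCS.correlation s (W i ω) (y i ω) x) P ∧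
            c₀ * √(Real.log q / (1 + (σ : ℝ) ^ 2))
              ≤ ∫ ω, QaryCS.correlation s (W i ω) (y i ω) x ∂P) ∧
          ∀ δ : ℝ, 0 < δ → ENNReal.ofReal (C / δ ^ 2) * QaryCS.meanWidth K ^ 2 ≤ (m : ℝ≥0∞) →
            QaryCS.RecoversWithin s K x P W y
              (δ * √(1 + (σ : ℝ) ^ 2) / √(Real.log q))
              (8 * Real.exp (-(c * δ ^ 2 * m)))) ∧
        -- inexact maximum
        (∀ (p : unitInterval) (b : Fin m → Ω → Bool) (r : Fin m → Ω → Fin q),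
          1 / 2 < (p : ℝ) → QaryCS.InexactMaximum s x p P W b r y →
          (∀ i, Integrable (fun ω => QaryCS.correlation s (W i ω) (y i ω) x) P ∧
            c₀ * (2 * (p : ℝ) - 1) * √(Real.log q)
              ≤ ∫ ω, QaryCS.correlation s (W i ω) (y i ω) x ∂P) ∧
          ∀ δ : ℝ, 0 < δ → ENNReal.ofReal (C / δ ^ 2) * QaryCS.meanWidth K ^ 2 ≤ (m : ℝ≥0∞) →
            (δ ≤ 1 → QaryCS.RecoversWithin s K x P W y
              (δ / (√(Real.log q) * (2 * (p : ℝ) - 1)))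
              (8 * Real.exp (-(c * δ ^ 2 * m)))) ∧
            QaryCS.RecoversWithin s K x P W y
              (δ / (√(Real.log q) * (2 * (p : ℝ) - 1)))
              (8 * Real.exp (-(c / Real.log q * δ ^ 2 * m)))) := by
  refine ⟨61440 ^ 2, (1 / 240) ^ 2 / 2 ^ 22, 1 / 240, by norm_num, by norm_num, by norm_num, ?_⟩
  intro q d m s K x Ω _ P _ W y hq hs hxK hx
  exact ⟨fun σ g h => h.recovers hs hq hxK hx, fun p b r hp h => h.recovers hp hs hq hxK hx⟩
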